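/- **Theorem (efficient algorithm in the Robertson–Webb model).** There are four agents. Agent $i$ has an additive valuation $v_i:[0,1]^2\to[0,1]$, i.e. there is a Lebesgue integrable density $f_i:[0,1]\to[0,\infty)$ with $v_i(a,b)=\int_a^b f_i(x)\,dx$ for $0\le a\le b\le 1$; moreover $v_i(a,b)=0$ for $b\le a$, and $v_i(0,1)=1$. No bound on $f_i$ (no Lipschitz bound on $v_i$) is assumed. In the Robertson–Webb query model a deterministic adaptive protocol may ask value queries (agent $i$, points $x,y\in[0,1]$; the reply is $v_i(x,y)$) and cut queries (agent $i$, a point $x\in[0,1]$ and a value $\alpha$; the reply is some, not necessarily unique, point $y\in[0,1]$ with $v_i(x,y)=\alpha$, or the message that there is no such $y$), and finally outputs a connected allocation: cuts $0\le\ell\le m\le r\le1$ and a bijective assignment of the four intervals $[0,\ell],[\ell,m],[m,r],[r,1]$ to the agents, so that agent $i$ receives an interval $A_i$. The allocation is $\varepsilon$-envy-free if $v_i(A_i)\ge v_i(A_j)-\varepsilon$ for all agents $i,j$. The complexity of a protocol is the largest number of queries it makes, over all additive valuations and all admissible replies. An $\varepsilon$-envy-free connected allocation can be computed using $O(\log^2(1/\varepsilon))$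 value and cut queries. That is, there are a constant $C$ and protocols $P_\varepsilon$ $(0<\varepsilon\le 1)$ such that, for all additive valuations of the four agents and all admissible replies, $P_\varepsilon$ outputs an $\varepsilon$-envy-free connected allocation and, if $\varepsilon\le 1/2$, makes at most $C\log^2(1/\varepsilon)$ queries. In particular the conjecture of Brânzei and Nisan is false: there do not exist $c,\varepsilon_0>0$ such that for every $\varepsilon\in(0,\varepsilon_0)$ every protocol that always computes an $\varepsilon$-envy-free connected allocation for four agents with additive valuations has complexity at least $c/\varepsilon$. -/

import Mathlib

open unitInterval MeasureTheory

/-- An additive valuation on the cake `[0,1]`: `v a b` is the value of the piece `[a,b]`, given by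
integrating a nonnegative Lebesgue integrable density over `[a,b]`. There is no bound on the
density, so `v` need not be Lipschitz. The value is `0` when `b ≤ a`, and the whole cake has
value `1`. -/
structure IsAdditiveValuation (v : I → I → ℝ) : Prop where
  exists_density : ∃ f : ℝ → ℝ, (∀ x ∈ Set.Icc (0 : ℝ) 1, 0 ≤ f x) ∧
    IntegrableOn f (Set.Icc 0 1) volume ∧
    ∀ a b : I, a ≤ b → v a b = ∫ x in (a : ℝ)..(b : ℝ), f x
  eq_zero : ∀ a b : I, b ≤ a → v a b = 0
  total : v 0 1 = 1

/-- A connected allocation of the cake to `n` agents: the cuts `0 = cut 0 ≤ ⋯ ≤ cut n = 1` divide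
the cake into the `n` intervals `[cut k, cut (k+1)]`, and agent `i` receives interval number
`assign i`. -/
structure ConnectedAllocation (n : ℕ) where
  cut : Fin (n + 1) → I
  monotone_cut : Monotone cut
  cut_zero : cut 0 = 0
  cut_last : cut (Fin.last n) = 1
  assign : Equiv.Perm (Fin n)

namespace ConnectedAllocation

variable {n : ℕ}

/-- Left endpoint of the piece of agent `i`. -/
def left (A : ConnectedAllocation n) (i : Fin n) : I := A.cut (A.assign i).castSucc

/-- Right endpoint of the piece of agent `i`. -/
def right (A : ConnectedAllocation n) (i : Fin n) : I := A.cut (A.assign i).succ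

/-- No agent prefers another agent's piece to her own by more than `ε`. -/
def IsEpsEnvyFree (A : ConnectedAllocation n) (v : Fin n → I → I → ℝ) (ε : ℝ) : Prop :=
  ∀ i j : Fin n, v i (A.left i) (A.right i) ≥ v i (A.left j) (A.right j) - ε

end ConnectedAllocation

/-- A deterministic adaptive protocol in the Robertson–Webb query model with `n` agents, as a
decision tree. It either stops with an allocation, or asks agent `i` for the value of the piece
`[x,y]`, or asks agent `i` to cut a piece of value `α` starting at `x`. After a query it continues
depending on the reply; the reply `none` to a cut query means that no such cut exists. -/
inductive RWProtocol (n : ℕ) : Type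
  | output (A : ConnectedAllocation n) : RWProtocol n
  | value (i : Fin n) (x y : I) (next : ℝ → RWProtocol n) : RWProtocol n
  | cut (i : Fin n) (x : I) (α : ℝ) (next : Option I → RWProtocol n) : RWProtocol n

namespace RWProtocol

variable {n : ℕ}

/-- `Run v P q A`: on valuations `v` there is an execution of `P`, with truthful replies, which
makes exactly `q` queries and outputs `A`. A cut query `(x, α)` may be answered by any position
`y` with `v i x y = α` (it need not be unique, and repeated queries may get different replies),
and it is answered by `none` only when there is no such position. -/
inductive Run (v : Fin n → I → I → ℝ) :
    RWProtocol n → ℕ → ConnectedAllocation n → Prop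
  | output (A : ConnectedAllocation n) : Run v (.output A) 0 A
  | value (i : Fin n) (x y : I) (next : ℝ → RWProtocol n) (q : ℕ) (A : ConnectedAllocation n)
      (h : Run v (next (v i x y)) q A) : Run v (.value i x y next) (q + 1) A
  | cut_some (i : Fin n) (x : I) (α : ℝ) (next : Option I → RWProtocol n) (q : ℕ)
      (A : ConnectedAllocation n) (y : I) (hy : v i x y = α)
      (h : Run v (next (some y)) q A) : Run v (.cut i x α next) (q + 1) A
  | cut_none (i : Fin n) (x : I) (α : ℝ) (next : Option I → RWProtocol n) (q : ℕ)
      (A : ConnectedAllocation n) (hα : ∀ y : I, v i x y ≠ α)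
      (h : Run v (next none) q A) : Run v (.cut i x α next) (q + 1) A

/-- Every execution of `P` on additive valuations outputs an `ε`-envy-free connected allocation. -/
def ComputesEpsEnvyFree (P : RWProtocol n) (ε : ℝ) : Prop :=
  ∀ v : Fin n → I → I → ℝ, (∀ i, IsAdditiveValuation (v i)) →
    ∀ (q : ℕ) (A : ConnectedAllocation n), Run v P q A → A.IsEpsEnvyFree v ε

/-- Every execution of `P` on additive valuations makes at most `N` queries. -/
def QueriesAtMost (P : RWProtocol n) (N : ℝ) : Prop :=
  ∀ v : Fin n → I → I → ℝ, (∀ i, IsAdditiveValuation (v i)) →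
    ∀ (q : ℕ) (A : ConnectedAllocation n), Run v P q A → (q : ℝ) ≤ N

end RWProtocol

/-- The Brânzei–Nisan conjecture: computing an `ε`-envy-free connected allocation for four agents
with additive valuations requires `Ω(1/ε)` value and cut queries. -/
def BranzeiNisanConjecture : Prop :=
  ∃ c : ℝ, 0 < c ∧ ∃ ε₀ : ℝ, 0 < ε₀ ∧ ∀ ε : ℝ, 0 < ε → ε < ε₀ →
    ∀ (P : RWProtocol 4) (N : ℕ), P.ComputesEpsEnvyFree ε → P.QueriesAtMost N → c / ε ≤ N

/-!
The idea is to follow a path of divisions along which agent `0` stays content, and to find its end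
by bisection.

Fix a level `α` and two pieces `i ≠ j`. Let the other two pieces have value `α` to agent `0`, and
let `s` be the value of piece `i` to her. As `s` grows, piece `i` gets better and piece `j` gets
worse for everybody, so each of the agents `1`, `2`, `3` is indifferent between `i` and `j` at one
value of `s`. Take for `s` the median of these three values, clamped to the range
`1 - 3 * α ≤ s ≤ α` in which agent `0` has no reason to prefer `i` or `j` to the other pieces.
Call the pair *attractive* at level `α` if in this division each of the agents `1`, `2`, `3` has a
favourite among `i` and `j`. At level `1 / 4` the division is into equal parts, and either some pair
is attractive or the favourites are distinct and the division is envy-free. At level `1 / 2` the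
pieces `i` and `j` are empty and no pair is attractive. If a pair is attractive at a level and no
pair is attractive at a slightly higher one, then the division of the pair is nearly envy-free
(`BiLip.exists_perm_of_step`): if the parameter is not clamped, two agents like `i`, two like `j`,
and somebody also likes a third piece, which gives a matching (`matched_pair`); if it is clamped,
two agents like a piece `k` and agent `0` likes all others, and, unless there is a matching, all
agents like only `k` and one other piece `j` (`subset_pair_of_not_matched`), so that the pair
`k`, `j` is attractive at the next level (`BiLip.corner_matched`). Hence bisection over `α` finds a
division as required.

All this is done with tolerances. Every valuation is mixed with a small portion of the average
valuation; in the coordinate in which agent `0` is uniform the mixed valuations then have slopes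
bounded above and below by multiples of `ε` and `1 / ε` (`exists_biLip`), so approximate medians are
near true ones and errors grow by powers of `1 / ε` only.

It remains to find the median at one level with `O(log (1 / ε))` queries. In the coordinate of
agent `0` the right end `x` of piece `i` and the left end `y` of piece `j` have a prescribed
distance, while the comparison of `i` and `j` is monotone in `x` and in `y`. Keep an interval for
either point, and split both: the two tests at the splitting points always exclude one part of one
interval (`realizes_searchStep`). Letting the agent with the largest share halve an interval removes
at least an eighth of its total value to all agents (`realizes_splitPoint`), so logarithmically many
steps suffice, although no single query cuts a mixed valuation. With `O(log (1 / ε))` levels this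
makes `O(log² (1 / ε))` queries, and no lower bound of order `1 / ε` can hold.
-/

/-! ### Divisions in the coordinate of agent `0` -/

/-- The agents `a`, seen through the coordinate in which agent `0` is uniform: `h a t` is the value
that agent `a` gives to the piece `[0, t]`. The functions are extended to the whole line, and
their slopes lie between `κ` and `κ⁻¹`. -/
structure BiLip (κ : ℝ) (h : Fin 4 → ℝ → ℝ) : Prop where
  pos : 0 < κ
  le_one : κ ≤ 1
  lower : ∀ a x y, x ≤ y → κ * (y - x) ≤ h a y - h a x
  upper : ∀ a x y, x ≤ y → κ * (h a y - h a x) ≤ y - x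
  base : ∀ x, h 0 x = x

/-- The value of piece `k` to agent `a` if the cuts are `c`. -/
def piece (h : Fin 4 → ℝ → ℝ) (c : Fin 5 → ℝ) (a k : Fin 4) : ℝ :=
  h a (c k.succ) - h a (c k.castSucc)

/-- Agent `a` prefers no piece to piece `k` by more than `t`. -/
def Fav (h : Fin 4 → ℝ → ℝ) (c : Fin 5 → ℝ) (t : ℝ) (a k : Fin 4) : Prop :=
  ∀ m, piece h c a m ≤ piece h c a k + t

/-- The cuts of the division whose pieces have the lengths `l`. -/
def cutsOf (l : Fin 4 → ℝ) (k : Fin 5) : ℝ := ∑ m : Fin 4, if m.castSucc < k then l m else 0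

/-- The lengths in the division of level `α` with parameter `s` for the pair `i`, `j`: piece `i`
has length `s`, piece `j` has what is left, and the other two pieces have length `α`. -/
def pairLen (i j : Fin 4) (α s : ℝ) (k : Fin 4) : ℝ :=
  if k = i then s else if k = j then 1 - 2 * α - s else α

/-- The cuts belonging to `pairLen`. -/
def pairCuts (i j : Fin 4) (α s : ℝ) : Fin 5 → ℝ := cutsOf (pairLen i j α s)

/-- The cuts of the division in which all pieces but `k` have length `α`. -/
def cornerCuts (k : Fin 4) (α : ℝ) : Fin 5 → ℝ := cutsOf fun m => if m = k then 1 - 3 * α else α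

/-- At least two of the agents `1`, `2`, `3` satisfy `p`. -/
def TwoAgents (p : Fin 4 → Prop) : Prop := ∃ a b : Fin 4, a ≠ 0 ∧ b ≠ 0 ∧ a ≠ b ∧ p a ∧ p b

/-- Up to `η`, the parameter `s` is the median, over the agents `1`, `2`, `3`, of the parameters
that make the pieces `i` and `j` equally good, clamped to the range `[1 - 3 * α, α]` in which
agent `0` prefers neither `i` nor `j` to the other two pieces. -/
structure IsMed (h : Fin 4 → ℝ → ℝ) (η : ℝ) (i j : Fin 4) (α s : ℝ) : Prop where
  ge : 1 - 3 * α ≤ s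
  le : s ≤ α
  two_le : 1 - 3 * α + η < s →
    TwoAgents fun a => piece h (pairCuts i j α s) a i ≤ piece h (pairCuts i j α s) a j + η
  two_ge : s < α - η →
    TwoAgents fun a => piece h (pairCuts i j α s) a j ≤ piece h (pairCuts i j α s) a i + η

theorem cutsOf_succ_sub (l : Fin 4 → ℝ) (k : Fin 4) :
    cutsOf l k.succ - cutsOf l k.castSucc = l k := by
  fin_cases k <;> simp [cutsOf, Fin.sum_univ_four]

theorem cutsOf_zero (l : Fin 4 → ℝ) : cutsOf l 0 = 0 := by simp [cutsOf]

theorem cutsOf_four (l : Fin 4 → ℝ) : cutsOf l 4 = ∑ k, l k := by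
  simp [cutsOf, Fin.sum_univ_four]

theorem abs_cutsOf_sub_le {l l' : Fin 4 → ℝ} {e : ℝ} (he : ∀ k, |l k - l' k| ≤ e) (k : Fin 5) :
    |cutsOf l k - cutsOf l' k| ≤ 4 * e := by
  have h0 : 0 ≤ e := (abs_nonneg _).trans (he 0)
  calc |cutsOf l k - cutsOf l' k|
      = |∑ m : Fin 4,
          ((if m.castSucc < k then l m else 0) - if m.castSucc < k then l' m else 0)| := by
        rw [Finset.sum_sub_distrib]; rfl
    _ ≤ ∑ m : Fin 4, |(if m.castSucc < k then l m else 0) - if m.castSucc < k then l' m else 0| :=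
        Finset.abs_sum_le_sum_abs _ _
    _ ≤ ∑ _m : Fin 4, e := by
        refine Finset.sum_le_sum fun m _ => ?_
        split_ifs
        · exact he m
        · simpa using h0
    _ = 4 * e := by simp

theorem pairLen_swap {i j : Fin 4} (hij : i ≠ j) (α s : ℝ) :
    pairLen j i α (1 - 2 * α - s) = pairLen i j α s := by
  funext k
  unfold pairLen
  by_cases h1 : k = i
  · subst h1; simp [hij]
  · by_cases h2 : k = j <;> simp [h1, h2, hij.symm]

theorem pairCuts_swap {i j : Fin 4} (hij : i ≠ j) (α s : ℝ) :
    pairCuts j i α (1 - 2 * α - s) = pairCuts i j α s := by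
  rw [pairCuts, pairLen_swap hij, pairCuts]

theorem IsMed.swap {h : Fin 4 → ℝ → ℝ} {η : ℝ} {i j : Fin 4} {α s : ℝ} (hij : i ≠ j)
    (H : IsMed h η i j α s) : IsMed h η j i α (1 - 2 * α - s) := by
  refine ⟨by linarith [H.le], by linarith [H.ge], fun hs => ?_, fun hs => ?_⟩ <;>
    rw [pairCuts_swap hij]
  · exact H.two_ge (by linarith)
  · exact H.two_le (by linarith)

theorem sum_pairLen {i j : Fin 4} (hij : i ≠ j) (α s : ℝ) : ∑ k, pairLen i j α s k = 1 := by
  fin_cases i <;> fin_cases j <;> simp_all [pairLen, Fin.sum_univ_four] <;> ring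

theorem pairCuts_four {i j : Fin 4} (hij : i ≠ j) (α s : ℝ) : pairCuts i j α s 4 = 1 := by
  rw [pairCuts, cutsOf_four, sum_pairLen hij]

section
variable {κ : ℝ} {h : Fin 4 → ℝ → ℝ}

theorem BiLip.abs_sub_le (H : BiLip κ h) (a : Fin 4) {x y r : ℝ} (hr : |x - y| ≤ r) :
    κ * |h a x - h a y| ≤ r := by
  rcases le_total x y with hxy | hxy
  · have h1 := H.lower a x y hxy
    have h2 := H.upper a x y hxy
    have h3 : 0 ≤ κ * (y - x) := mul_nonneg H.pos.le (by linarith)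
    rw [abs_sub_comm, abs_of_nonneg (by linarith)]
    rw [abs_sub_comm, abs_of_nonneg (by linarith)] at hr
    linarith
  · have h1 := H.lower a y x hxy
    have h2 := H.upper a y x hxy
    have h3 : 0 ≤ κ * (x - y) := mul_nonneg H.pos.le (by linarith)
    rw [abs_of_nonneg (by linarith)]
    rw [abs_of_nonneg (by linarith)] at hr
    linarith

theorem BiLip.mono (H : BiLip κ h) (a : Fin 4) : Monotone (h a) := fun x y hxy => by
  have h1 := H.lower a x y hxy
  have h3 : 0 ≤ κ * (y - x) := mul_nonneg H.pos.le (by linarith)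
  linarith

theorem BiLip.piece_close (H : BiLip κ h) {c c' : Fin 5 → ℝ} {r : ℝ} (hc : ∀ k, |c k - c' k| ≤ r)
    (a k : Fin 4) : κ * |piece h c a k - piece h c' a k| ≤ 2 * r := by
  have h1 := H.abs_sub_le a (hc k.succ)
  have h2 := H.abs_sub_le a (hc k.castSucc)
  have h3 : |piece h c a k - piece h c' a k| ≤ |h a (c k.succ) - h a (c' k.succ)|
      + |h a (c k.castSucc) - h a (c' k.castSucc)| := by
    unfold piece
    have := abs_sub (h a (c k.succ) - h a (c' k.succ)) (h a (c k.castSucc) - h a (c' k.castSucc))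
    refine le_trans (le_of_eq ?_) this
    congr 1; ring
  nlinarith [mul_le_mul_of_nonneg_left h3 H.pos.le]

/-- Approximate favourites survive a small move of the cuts. -/
theorem BiLip.fav_of_close (H : BiLip κ h) {c c' : Fin 5 → ℝ} {r t t' : ℝ} {a k : Fin 4}
    (hc : ∀ k, |c k - c' k| ≤ r) (hr : 4 * r ≤ κ * (t' - t)) (hf : Fav h c t a k) :
    Fav h c' t' a k := by
  intro m
  have h1 := (abs_le.1 (le_refl |piece h c a m - piece h c' a m|)).1
  have h2 := (abs_le.1 (le_refl |piece h c a k - piece h c' a k|)).2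
  have h3 := H.piece_close hc a m
  have h4 := H.piece_close hc a k
  have h5 := hf m
  have h6 : κ * (|piece h c a m - piece h c' a m| + |piece h c a k - piece h c' a k|)
      ≤ κ * (t' - t) := by linarith
  have h7 := le_of_mul_le_mul_left h6 H.pos
  linarith

theorem BiLip.fav_of_len_close (H : BiLip κ h) {l l' : Fin 4 → ℝ} {e t t' : ℝ} {a k : Fin 4}
    (hc : ∀ k, |l k - l' k| ≤ e) (hr : 16 * e ≤ κ * (t' - t)) (hf : Fav h (cutsOf l) t a k) :
    Fav h (cutsOf l') t' a k :=
  H.fav_of_close (abs_cutsOf_sub_le hc) (by linarith) hf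

theorem Fav.mono {c : Fin 5 → ℝ} {t t' : ℝ} {a k : Fin 4} (hf : Fav h c t a k) (ht : t ≤ t') :
    Fav h c t' a k := fun m => (hf m).trans (by linarith)

theorem exists_fav (h : Fin 4 → ℝ → ℝ) (c : Fin 5 → ℝ) (a : Fin 4) : ∃ k, Fav h c 0 a k := by
  obtain ⟨k, hk⟩ := Finite.exists_max (piece h c a)
  exact ⟨k, fun m => by simpa using hk m⟩

theorem BiLip.piece_zero (H : BiLip κ h) (l : Fin 4 → ℝ) (k : Fin 4) :
    piece h (cutsOf l) 0 k = l k := by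
  rw [piece, H.base, H.base, cutsOf_succ_sub]

/-- Raising the parameter makes piece `i` better and piece `j` worse. -/
theorem BiLip.piece_sub_mono (H : BiLip κ h) {i j : Fin 4} (hij : i ≠ j) (a : Fin 4) {α s s' : ℝ}
    (hs : s ≤ s') :
    piece h (pairCuts i j α s) a i - piece h (pairCuts i j α s) a j + κ * (s' - s) ≤
      piece h (pairCuts i j α s') a i - piece h (pairCuts i j α s') a j := by
  obtain ⟨h1, h2, h3, h4⟩ : pairCuts i j α s i.succ ≤ pairCuts i j α s' i.succ ∧
      pairCuts i j α s' i.castSucc ≤ pairCuts i j α s i.castSucc ∧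
      pairCuts i j α s' j.succ ≤ pairCuts i j α s j.succ ∧
      pairCuts i j α s j.castSucc ≤ pairCuts i j α s' j.castSucc := by
    fin_cases i <;> fin_cases j <;> first | exact absurd rfl hij | skip
    all_goals
      simp [pairCuts, cutsOf, pairLen, Fin.sum_univ_four]
      first
        | linarith
        | (refine ⟨?_, ?_⟩ <;> linarith)
        | (refine ⟨?_, ?_, ?_⟩ <;> linarith)
  have e1 : pairCuts i j α s i.succ - pairCuts i j α s i.castSucc = s := by
    rw [pairCuts, cutsOf_succ_sub]; simp [pairLen]
  have e2 : pairCuts i j α s' i.succ - pairCuts i j α s' i.castSucc = s' := by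
    rw [pairCuts, cutsOf_succ_sub]; simp [pairLen]
  have l1 := H.lower a _ _ h1
  have l2 := H.lower a _ _ h2
  have l3 := H.mono a h3
  have l4 := H.mono a h4
  unfold piece
  have : κ * (s' - s) = κ * (pairCuts i j α s' i.succ - pairCuts i j α s i.succ)
    + κ * (pairCuts i j α s i.castSucc - pairCuts i j α s' i.castSucc) := by
    rw [← mul_add]; congr 1; linarith
  linarith

end

/-! ### Matchings of three agents -/

theorem TwoAgents.imp {p q : Fin 4 → Prop} (hp : TwoAgents p) (hpq : ∀ a, a ≠ 0 → p a → q a) :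
    TwoAgents q := by
  obtain ⟨a, b, ha, hb, hab, pa, pb⟩ := hp
  exact ⟨a, b, ha, hb, hab, hpq a ha pa, hpq b hb pb⟩

theorem eq_or_eq_or_eq_of_ne_zero {a b c d : Fin 4} (hb : b ≠ 0) (hc : c ≠ 0) (hd : d ≠ 0)
    (hbc : b ≠ c) (hbd : b ≠ d) (hcd : c ≠ d) (ha : a ≠ 0) : a = b ∨ a = c ∨ a = d := by
  omega

theorem TwoAgents.exists_both {p q : Fin 4 → Prop} (hp : TwoAgents p) (hq : TwoAgents q) :
    ∃ a, a ≠ 0 ∧ p a ∧ q a := by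
  obtain ⟨a, b, ha, hb, hab, pa, pb⟩ := hp
  obtain ⟨c, d, hc, hd, hcd, qc, qd⟩ := hq
  by_cases h1 : a = c
  · exact ⟨a, ha, pa, h1 ▸ qc⟩
  by_cases h2 : a = d
  · exact ⟨a, ha, pa, h2 ▸ qd⟩
  by_cases h3 : b = c
  · exact ⟨b, hb, pb, h3 ▸ qc⟩
  have h4 : b = d := by omega
  exact ⟨b, hb, pb, h4 ▸ qd⟩

theorem twoAgents_not_of_not {p : Fin 4 → Prop} (hp : ¬ TwoAgents p) :
    TwoAgents fun a => ¬ p a := by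
  have h1 : ¬ (p 1 ∧ p 2) := fun h => hp ⟨1, 2, by decide, by decide, by decide, h.1, h.2⟩
  have h2 : ¬ (p 1 ∧ p 3) := fun h => hp ⟨1, 3, by decide, by decide, by decide, h.1, h.2⟩
  have h3 : ¬ (p 2 ∧ p 3) := fun h => hp ⟨2, 3, by decide, by decide, by decide, h.1, h.2⟩
  by_cases q1 : p 1
  · exact ⟨2, 3, by decide, by decide, by decide, fun h => h1 ⟨q1, h⟩, fun h => h2 ⟨q1, h⟩⟩
  · by_cases q2 : p 2
    · exact ⟨1, 3, by decide, by decide, by decide, q1, fun h => h3 ⟨q2, h⟩⟩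
    · exact ⟨1, 2, by decide, by decide, by decide, q1, q2⟩

theorem exists_third {b c : Fin 4} (hb : b ≠ 0) (hc : c ≠ 0) (hbc : b ≠ c) :
    ∃ d : Fin 4, d ≠ 0 ∧ b ≠ d ∧ c ≠ d := by
  revert b c; decide

theorem exists_perm_of_three {b c d x y z : Fin 4} (hb : b ≠ 0) (hc : c ≠ 0) (hd : d ≠ 0)
    (hbc : b ≠ c) (hbd : b ≠ d) (hcd : c ≠ d) (hxy : x ≠ y) (hxz : x ≠ z) (hyz : y ≠ z) :
    ∃ g : Equiv.Perm (Fin 4), g b = x ∧ g c = y ∧ g d = z := by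
  obtain ⟨w, hwx, hwy, hwz⟩ : ∃ w : Fin 4, w ≠ x ∧ w ≠ y ∧ w ≠ z := by
    revert x y z; decide
  have key : ∀ {p q r t : Fin 4}, p ≠ q → p ≠ r → p ≠ t → q ≠ r → q ≠ t → r ≠ t →
      Function.Bijective ![p, q, r, t] := by
    intro p q r t h1 h2 h3 h4 h5 h6
    refine Finite.injective_iff_bijective.1 fun m n hmn => ?_
    fin_cases m <;> fin_cases n <;> first | rfl | (simp at hmn; omega)
  let e := Equiv.ofBijective _ (key hb.symm hc.symm hd.symm hbc hbd hcd)
  let f := Equiv.ofBijective _ (key hwx hwy hwz hxy hxz hyz)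
  refine ⟨e.symm.trans f, ?_, ?_, ?_⟩
  · exact congrArg f (e.symm_apply_apply 1)
  · exact congrArg f (e.symm_apply_apply 2)
  · exact congrArg f (e.symm_apply_apply 3)

/-- The agents `1`, `2`, `3` can be given distinct pieces which they like according to `F`, such
that the pieces satisfying `p` are among them. -/
def Matched (F : Fin 4 → Fin 4 → Prop) (p : Fin 4 → Prop) : Prop :=
  ∃ g : Equiv.Perm (Fin 4), ¬ p (g 0) ∧ ∀ a, a ≠ 0 → F a (g a)

theorem matched_of_three {F : Fin 4 → Fin 4 → Prop} {p : Fin 4 → Prop} {b c d x y z : Fin 4}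
    (hb : b ≠ 0) (hc : c ≠ 0) (hd : d ≠ 0) (hbc : b ≠ c) (hbd : b ≠ d) (hcd : c ≠ d)
    (hxy : x ≠ y) (hxz : x ≠ z) (hyz : y ≠ z) (hp : ∀ k, p k → k = x ∨ k = y ∨ k = z)
    (fb : F b x) (fc : F c y) (fd : F d z) : Matched F p := by
  obtain ⟨g, s1, s2, s3⟩ := exists_perm_of_three hb hc hd hbc hbd hcd hxy hxz hyz
  refine ⟨g, fun h0 => ?_, fun a ha => ?_⟩
  · rcases hp _ h0 with h | h | h
    · exact hb (g.injective (s1.trans h.symm))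
    · exact hc (g.injective (s2.trans h.symm))
    · exact hd (g.injective (s3.trans h.symm))
  · rcases eq_or_eq_or_eq_of_ne_zero hb hc hd hbc hbd hcd ha with h | h | h
    · rw [h, s1]; exact fb
    · rw [h, s2]; exact fc
    · rw [h, s3]; exact fd

theorem TwoAgents.or_of_third {p : Fin 4 → Prop} (hp : TwoAgents p) {b c d : Fin 4} (hb : b ≠ 0)
    (hc : c ≠ 0) (hd : d ≠ 0) (hbc : b ≠ c) (hbd : b ≠ d) (hcd : c ≠ d) :
    (p b ∧ p c) ∨ (p b ∧ p d) ∨ (p c ∧ p d) := by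
  obtain ⟨x, y, hx, hy, hxy, px, py⟩ := hp
  rcases eq_or_eq_or_eq_of_ne_zero hb hc hd hbc hbd hcd hx with rfl | rfl | rfl <;>
  rcases eq_or_eq_or_eq_of_ne_zero hb hc hd hbc hbd hcd hy with rfl | rfl | rfl <;> simp_all

/-- If two agents like `i`, two like `j`, and someone likes a third piece, then there is a matching
that uses `i` and `j`. -/
theorem matched_pair {F : Fin 4 → Fin 4 → Prop} {i j : Fin 4} (hij : i ≠ j)
    (hne : ∀ a, ∃ k, F a k) (hi : TwoAgents fun a => F a i) (hj : TwoAgents fun a => F a j)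
    (hp : ∃ a, a ≠ 0 ∧ ∃ k, k ≠ i ∧ k ≠ j ∧ F a k) : Matched F fun k => k = i ∨ k = j := by
  obtain ⟨a, ha, p, hpi, hpj, hap⟩ := hp
  obtain ⟨b, c, hb, hc, hab, hac, hbc⟩ : ∃ b c : Fin 4, b ≠ 0 ∧ c ≠ 0 ∧ a ≠ b ∧ a ≠ c ∧ b ≠ c := by
    clear hap; revert a; decide
  have Hi := hi.or_of_third ha hb hc hab hac hbc
  have Hj := hj.or_of_third ha hb hc hab hac hbc
  have key : ∀ b c : Fin 4, b ≠ 0 → c ≠ 0 → a ≠ b → a ≠ c → b ≠ c → F a i → F a j → F b i →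
      F b j → Matched F fun k => k = i ∨ k = j := by
    intro b c hb hc hab hac hbc h1 h2 h3 h4
    obtain ⟨q, hq⟩ := hne c
    by_cases hqi : q = i
    · subst hqi
      exact matched_of_three ha hb hc hab hac hbc (x := p) hpj hpi hij.symm
        (by rintro k (h | h) <;> simp [h]) hap h4 hq
    by_cases hqj : q = j
    · subst hqj
      exact matched_of_three ha hb hc hab hac hbc (x := p) hpi hpj hij
        (by rintro k (h | h) <;> simp [h]) hap h3 hq
    · exact matched_of_three ha hb hc hab hac hbc hij (Ne.symm hqi) (Ne.symm hqj)
        (by rintro k (h | h) <;> simp [h]) h1 h4 hq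
  by_cases h1 : F b i ∧ F c j
  · exact matched_of_three ha hb hc hab hac hbc hpi hpj hij
      (by rintro k (h | h) <;> simp [h]) hap h1.1 h1.2
  by_cases h2 : F b j ∧ F c i
  · exact matched_of_three ha hb hc hab hac hbc hpj hpi hij.symm
      (by rintro k (h | h) <;> simp [h]) hap h2.1 h2.2
  by_cases hbi : F b i
  · have := key b c hb hc hab hac hbc; tauto
  · have := key c b hc hb hac hab hbc.symm; tauto

/-- Suppose that two agents like `i` and that two agents like something else. If no matching uses
`i`, then all agents like only `i` and one further piece. -/
theorem subset_pair_of_not_matched {F : Fin 4 → Fin 4 → Prop} {i : Fin 4}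
    (hne : ∀ a, ∃ k, F a k) (hi : TwoAgents fun a => F a i)
    (ho : TwoAgents fun a => ∃ k, k ≠ i ∧ F a k) (hm : ¬ Matched F fun k => k = i) :
    ∃ j, j ≠ i ∧ ∀ a, a ≠ 0 → ∀ k, F a k → k = i ∨ k = j := by
  obtain ⟨b, hb, hbi, j, hji, hbj⟩ := hi.exists_both ho
  obtain ⟨c, d, hc, hd, hbc, hbd, hcd⟩ :
      ∃ c d : Fin 4, c ≠ 0 ∧ d ≠ 0 ∧ b ≠ c ∧ b ≠ d ∧ c ≠ d := by
    clear hbi hbj; revert b; decide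
  -- Otherwise `p`, `q` and `i` would be a matching.
  have no : ∀ x y z : Fin 4, x ≠ 0 → y ≠ 0 → z ≠ 0 → x ≠ y → x ≠ z → y ≠ z → ∀ p q : Fin 4,
      F x p → F y q → F z i → p ≠ i → q ≠ i → p = q := by
    intro x y z hx hy hz hxy hxz hyz p q fp fq fi hp hq
    by_contra hpq
    exact hm (matched_of_three hx hy hz hxy hxz hyz hpq hp hq (by rintro k rfl; simp) fp fq fi)
  have key : ∀ c d : Fin 4, c ≠ 0 → d ≠ 0 → b ≠ c → b ≠ d → c ≠ d → F c i →
      ∃ j, j ≠ i ∧ ∀ a, a ≠ 0 → ∀ k, F a k → k = i ∨ k = j := by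
    intro c d hc hd hbc hbd hcd hci
    have Ho := ho.or_of_third hb hc hd hbc hbd hcd
    refine ⟨j, hji, ?_⟩
    have Hd : ∀ k, F d k → k ≠ i → k = j := fun k hk hki =>
      (no b d c hb hd hc hbd hbc hcd.symm j k hbj hk hci hji hki).symm
    by_cases hdj : F d j
    · have Hb : ∀ k, F b k → k ≠ i → k = j := fun k hk hki =>
        no b d c hb hd hc hbd hbc hcd.symm k j hk hdj hci hki hji
      have Hc : ∀ k, F c k → k ≠ i → k = j := fun k hk hki =>
        no c d b hc hd hb hcd hbc.symm hbd.symm k j hk hdj hbi hki hji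
      intro a ha k hk
      by_contra! hcon
      rcases eq_or_eq_or_eq_of_ne_zero hb hc hd hbc hbd hcd ha with rfl | rfl | rfl
      · exact hcon.2 (Hb k hk hcon.1)
      · exact hcon.2 (Hc k hk hcon.1)
      · exact hcon.2 (Hd k hk hcon.1)
    · have hdi : F d i := by
        obtain ⟨k, hk⟩ := hne d
        by_cases hki : k = i
        · exact hki ▸ hk
        · exact absurd (Hd k hk hki ▸ hk) hdj
      obtain ⟨j', hj'i, hcj'⟩ : ∃ k, k ≠ i ∧ F c k := by
        rcases Ho with h | h | h
        · exact h.2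
        · obtain ⟨k, hki, hk⟩ := h.2
          exact absurd (Hd k hk hki ▸ hk) hdj
        · exact h.1
      have Hc : ∀ k, F c k → k ≠ i → k = j := fun k hk hki =>
        (no b c d hb hc hd hbc hbd hcd j k hbj hk hdi hji hki).symm
      have hcj : F c j := Hc j' hcj' hj'i ▸ hcj'
      have Hb : ∀ k, F b k → k ≠ i → k = j := fun k hk hki =>
        no b c d hb hc hd hbc hbd hcd k j hk hcj hdi hki hji
      intro a ha k hk
      by_contra! hcon
      rcases eq_or_eq_or_eq_of_ne_zero hb hc hd hbc hbd hcd ha with rfl | rfl | rfl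
      · exact hcon.2 (Hb k hk hcon.1)
      · exact hcon.2 (Hc k hk hcon.1)
      · exact hcon.2 (Hd k hk hcon.1)
  rcases hi.or_of_third hb hc hd hbc hbd hcd with h | h | h
  · exact key c d hc hd hbc hbd hcd h.2
  · exact key d c hd hc hbd hbc hcd.symm h.2
  · exact key c d hc hd hbc hbd hcd h.1

/-! ### The step from one level to the next -/

/-- No pair attracts all agents at level `α`: for every pair there is an approximate median at which
some agent finds both pieces of the pair worse than another piece by more than `ξ`. -/
def FailsAt (h : Fin 4 → ℝ → ℝ) (η ξ α : ℝ) : Prop :=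
  ∀ i j : Fin 4, i ≠ j → ∃ s, IsMed h η i j α s ∧
    ∃ a, a ≠ 0 ∧ ¬ Fav h (pairCuts i j α s) ξ a i ∧ ¬ Fav h (pairCuts i j α s) ξ a j

section
variable {κ η : ℝ} {h : Fin 4 → ℝ → ℝ}

theorem pairCuts_corner {i j : Fin 4} (α : ℝ) :
    pairCuts i j α (1 - 3 * α) = cornerCuts i α := by
  unfold pairCuts cornerCuts
  congr 1
  funext k
  unfold pairLen
  split_ifs <;> ring

/-- If two agents like the short piece `k` of a corner division, then the median for every pair
containing `k` is near that corner. -/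
theorem BiLip.near_corner (H : BiLip κ h) {k j : Fin 4} (hkj : k ≠ j) {α s t : ℝ} (ht : 0 ≤ t)
    (h2 : TwoAgents fun a => Fav h (cornerCuts k α) t a k)
    (hs : IsMed h η k j α s) : κ * (s - (1 - 3 * α)) ≤ η + t := by
  by_cases h1 : 1 - 3 * α + η < s
  · obtain ⟨a, -, ha, hb⟩ := h2.exists_both (hs.two_le h1)
    have h3 := H.piece_sub_mono hkj a (α := α) hs.ge
    rw [pairCuts_corner] at h3
    have h4 := ha j
    linarith
  · have := hs.ge
    nlinarith [H.le_one, H.pos, mul_nonneg (sub_nonneg.2 H.le_one) (sub_nonneg.2 hs.ge)]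

theorem BiLip.fav_pair_of_corner (H : BiLip κ h) {k j : Fin 4} {α s t t' : ℝ}
    {a m : Fin 4} (hs1 : 1 - 3 * α ≤ s) (hs : 16 * (s - (1 - 3 * α)) ≤ κ * (t' - t)) :
    (Fav h (cornerCuts k α) t a m → Fav h (pairCuts k j α s) t' a m) ∧
    (Fav h (pairCuts k j α s) t a m → Fav h (cornerCuts k α) t' a m) := by
  have hclose : ∀ q, |pairLen k j α s q - pairLen k j α (1 - 3 * α) q| ≤ s - (1 - 3 * α) := by
    intro q
    unfold pairLen
    split_ifs
    · rw [abs_of_nonneg (by linarith)]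
    · rw [abs_le]; constructor <;> linarith
    · simp; linarith
  rw [← pairCuts_corner (i := k) (j := j)]
  refine ⟨fun hf => H.fav_of_len_close (fun q => ?_) hs hf, fun hf =>
    H.fav_of_len_close hclose hs hf⟩
  rw [abs_sub_comm]
  exact hclose q

/-- At a corner whose short piece is liked by two agents, there is a matching unless some pair
attracts all agents. -/
theorem BiLip.corner_matched (H : BiLip κ h) {ζ ξ θ α : ℝ} {k : Fin 4} (hζ : 0 ≤ ζ)
    (hξ : 16 * η ≤ κ ^ 2 * ξ) (hθ : 16 * (η + ζ) ≤ κ ^ 2 * θ) (hξ0 : 0 ≤ ξ) (hζθ : ζ ≤ θ)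
    (h2 : TwoAgents fun a => Fav h (cornerCuts k α) ζ a k) (hfail : FailsAt h η ξ α) :
    Matched (fun a m => Fav h (cornerCuts k α) θ a m) fun m => m = k := by
  have hκ := H.pos
  have hθ0 : 0 ≤ θ := hζ.trans hζθ
  by_contra hm
  -- If two agents find `k` best, a pair of `k` with a favourite of the third agent attracts all
  -- agents at the corner, hence also at the median, whose distance is of order `η`.
  by_cases hex : ∃ j, k ≠ j ∧ TwoAgents (fun a => Fav h (cornerCuts k α) 0 a k) ∧
      ∀ a, a ≠ 0 → Fav h (cornerCuts k α) 0 a k ∨ Fav h (cornerCuts k α) 0 a j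
  · obtain ⟨j, hkj, htwo, hall⟩ := hex
    obtain ⟨s, hs, a, ha, hak, haj⟩ := hfail k j hkj
    have hn := H.near_corner hkj le_rfl htwo hs
    have hc : 16 * (s - (1 - 3 * α)) ≤ κ * (ξ - 0) := by
      refine le_of_mul_le_mul_left ?_ hκ
      nlinarith
    rcases hall a ha with h' | h'
    · exact hak ((H.fav_pair_of_corner hs.ge hc).1 h')
    · exact haj ((H.fav_pair_of_corner hs.ge hc).1 h')
  · have hnot : ¬ TwoAgents fun a => Fav h (cornerCuts k α) 0 a k := by
      rintro ⟨b, c, hb, hc, hbc, fb, fc⟩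
      refine hex ?_
      obtain ⟨d, hd, hbd, hcd⟩ := exists_third hb hc hbc
      obtain ⟨j, hj⟩ := exists_fav h (cornerCuts k α) d
      obtain ⟨j', hj'k, hj'⟩ : ∃ j', k ≠ j' ∧
          (Fav h (cornerCuts k α) 0 d k ∨ Fav h (cornerCuts k α) 0 d j') := by
        by_cases hjk : k = j
        · obtain ⟨j', hj'⟩ := exists_ne k
          exact ⟨j', hj'.symm, Or.inl (hjk ▸ hj)⟩
        · exact ⟨j, hjk, Or.inr hj⟩
      refine ⟨j', hj'k, ⟨b, c, hb, hc, hbc, fb, fc⟩, fun a ha => ?_⟩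
      rcases eq_or_eq_or_eq_of_ne_zero hb hc hd hbc hbd hcd ha with rfl | rfl | rfl
      · exact Or.inl fb
      · exact Or.inl fc
      · exact hj'
    -- Now two agents like some piece other than `k`, so all like only `k` and one piece `j`.
    obtain ⟨j, hjk, hall⟩ := subset_pair_of_not_matched
      (fun a => (exists_fav h (cornerCuts k α) a).imp fun m hf => hf.mono hθ0)
      (h2.imp fun a _ hf => hf.mono hζθ)
      ((twoAgents_not_of_not hnot).imp fun a _ hf => by
        obtain ⟨m, hm⟩ := exists_fav h (cornerCuts k α) a
        exact ⟨m, fun hmk => hf (hmk ▸ hm), hm.mono hθ0⟩) hm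
    obtain ⟨s, hs, a, ha, hak, haj⟩ := hfail k j hjk.symm
    have hn := H.near_corner hjk.symm hζ h2 hs
    have hc : 16 * (s - (1 - 3 * α)) ≤ κ * (θ - 0) := by
      refine le_of_mul_le_mul_left ?_ hκ
      nlinarith
    obtain ⟨m, hm⟩ := exists_fav h (pairCuts k j α s) a
    rcases hall a ha m ((H.fav_pair_of_corner hs.ge hc).2 hm) with rfl | rfl
    · exact hak (hm.mono hξ0)
    · exact haj (hm.mono hξ0)

/-- The median moves continuously with the level. -/
theorem BiLip.med_le (H : BiLip κ h) {i j : Fin 4} (hij : i ≠ j) {α α' s s' : ℝ} (hη : 0 ≤ η)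
    (hαα : |α - α'| ≤ η) (hs : IsMed h η i j α s) (hs' : IsMed h η i j α' s') :
    κ ^ 2 * (s' - s) ≤ 34 * η := by
  have hκ := H.pos
  have hκ1 := H.le_one
  obtain ⟨ha1, ha2⟩ := abs_le.1 hαα
  by_contra! hcon
  have hκ2 : κ ^ 2 ≤ 1 := by nlinarith
  have hr : 34 * η < s' - s := by
    by_contra! h1
    rcases le_total 0 (s' - s) with h0 | h0
    · nlinarith
    · nlinarith [sq_nonneg κ]
  obtain ⟨a, -, hA, hB⟩ := (hs.two_ge (by linarith [hs'.le])).exists_both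
    (hs'.two_le (by linarith [hs.ge]))
  have h1 := H.piece_sub_mono hij a (α := α') (s := s) (s' := s') (by linarith)
  have hc : ∀ q, |pairLen i j α s q - pairLen i j α' s q| ≤ 2 * η := by
    intro q
    unfold pairLen
    split_ifs <;> rw [abs_le] <;> constructor <;> linarith
  have h2 := H.piece_close (abs_cutsOf_sub_le hc) a i
  have h3 := H.piece_close (abs_cutsOf_sub_le hc) a j
  change κ * |piece h (pairCuts i j α s) a i - piece h (pairCuts i j α' s) a i| ≤ _ at h2
  change κ * |piece h (pairCuts i j α s) a j - piece h (pairCuts i j α' s) a j| ≤ _ at h3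
  have h4 := mul_le_mul_of_nonneg_left
    (le_abs_self (piece h (pairCuts i j α s) a i - piece h (pairCuts i j α' s) a i)) hκ.le
  have h5 := mul_le_mul_of_nonneg_left
    (neg_abs_le (piece h (pairCuts i j α s) a j - piece h (pairCuts i j α' s) a j)) hκ.le
  have h6 := mul_le_mul_of_nonneg_left h1 hκ.le
  nlinarith

theorem BiLip.abs_med_sub_le (H : BiLip κ h) {i j : Fin 4} (hij : i ≠ j) {α α' s s' : ℝ}
    (hη : 0 ≤ η) (hαα : |α - α'| ≤ η) (hs : IsMed h η i j α s) (hs' : IsMed h η i j α' s') :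
    κ ^ 2 * |s' - s| ≤ 34 * η := by
  rcases abs_cases (s' - s) with h1 | h1 <;> rw [h1.1]
  · exact H.med_le hij hη hαα hs hs'
  · rw [neg_sub]
    exact H.med_le hij hη (by rwa [abs_sub_comm]) hs' hs

end

/-- The tolerances of the argument: `η` for medians and for the distance of consecutive levels,
`ξ` and `ζ` for what counts as failing and as passing the test, `θ` for the final envy. -/
structure Scales (κ η ξ ζ θ : ℝ) : Prop where
  nonneg : 0 ≤ η
  ξ_nonneg : 0 ≤ ξ
  ζ_nonneg : 0 ≤ ζ
  θ_nonneg : 0 ≤ θ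
  le_ξ : 16 * η ≤ κ ^ 2 * ξ
  le_ζ : 64 * η ≤ κ * (ζ - η)
  ζ_le : 16 * (η + 2 * ζ) ≤ κ ^ 2 * (θ / 2)
  le_θ : 576 * η ≤ κ ^ 3 * θ

section
variable {κ η ξ ζ θ : ℝ} {h : Fin 4 → ℝ → ℝ}

theorem BiLip.exists_perm_of_near_corner (H : BiLip κ h) (S : Scales κ η ξ ζ θ)
    {i j k : Fin 4} {α α' s : ℝ} (hα' : 1 / 4 ≤ α')
    (hc : ∀ q, |pairLen i j α s q - (if q = k then 1 - 3 * α' else α')| ≤ 4 * η)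
    (h2 : TwoAgents fun a => Fav h (pairCuts i j α s) (ζ + η) a k) (hfail : FailsAt h η ξ α') :
    ∃ g : Equiv.Perm (Fin 4), ∀ a, Fav h (pairCuts i j α s) θ a (g a) := by
  have hκ := H.pos
  have hκ1 := H.le_one
  have hη := S.nonneg
  have hζ := S.ζ_nonneg
  have hκ2 : κ ^ 2 ≤ 1 := by nlinarith
  have hκ3 : κ ^ 3 ≤ κ := by nlinarith
  obtain ⟨g, g0, hg⟩ := H.corner_matched (ζ := 2 * ζ) (θ := θ / 2) (by linarith) S.le_ξ S.ζ_le
    S.ξ_nonneg (by nlinarith [S.ζ_le, S.θ_nonneg])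
    (h2.imp fun a _ hf => H.fav_of_len_close hc (by linarith [S.le_ζ]) hf) hfail
  have hback : ∀ a m, Fav h (cornerCuts k α') (θ / 2) a m → Fav h (pairCuts i j α s) θ a m :=
    fun a m hf => H.fav_of_len_close (fun q => by rw [abs_sub_comm]; exact hc q)
      (by nlinarith [S.le_θ, S.θ_nonneg]) hf
  refine ⟨g, fun a => hback a (g a) ?_⟩
  by_cases ha : a = 0
  · subst ha
    intro m
    simp only [cornerCuts, H.piece_zero, if_neg g0]
    have := S.θ_nonneg
    split_ifs <;> linarith
  · exact hg a ha

/-- The step: if a pair attracts all agents at level `α` and no pair does at a neighbouring level,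
then the division of that pair is approximately envy-free. -/
theorem BiLip.exists_perm_of_step (H : BiLip κ h) (S : Scales κ η ξ ζ θ)
    {i j : Fin 4} (hij : i ≠ j) {α α' s : ℝ} (hα' : 1 / 4 ≤ α') (hαα : |α - α'| ≤ η)
    (hs : IsMed h η i j α s)
    (hpass : ∀ a, a ≠ 0 → Fav h (pairCuts i j α s) ζ a i ∨ Fav h (pairCuts i j α s) ζ a j)
    (hfail : FailsAt h η ξ α') :
    ∃ g : Equiv.Perm (Fin 4), ∀ a, Fav h (pairCuts i j α s) θ a (g a) := by
  have hκ := H.pos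
  have hκ1 := H.le_one
  have hη := S.nonneg
  have hζ := S.ζ_nonneg
  have hκ2 : κ ^ 2 ≤ 1 := by nlinarith
  obtain ⟨ha1, ha2⟩ := abs_le.1 hαα
  have hsge := hs.ge
  have hsle := hs.le
  -- Near either end of the range of the parameter, the division is near a corner.
  have hci : s ≤ 1 - 3 * α + η →
      ∀ q, |pairLen i j α s q - (if q = i then 1 - 3 * α' else α')| ≤ 4 * η := by
    intro h1 q
    unfold pairLen
    split_ifs <;> rw [abs_le] <;> constructor <;> linarith
  have hcj : α - η ≤ s →
      ∀ q, |pairLen i j α s q - (if q = j then 1 - 3 * α' else α')| ≤ 4 * η := by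
    intro h1 q
    unfold pairLen
    by_cases hqi : q = i
    · subst hqi
      simp only [if_true, hij, if_false]
      rw [abs_le]; constructor <;> linarith
    · simp only [hqi, if_false]
      split_ifs <;> rw [abs_le] <;> constructor <;> linarith
  have hge : s < α - η → TwoAgents fun a => Fav h (pairCuts i j α s) (ζ + η) a i := fun h1 =>
    (hs.two_ge h1).imp fun a ha hf => by
      rcases hpass a ha with hp | hp
      · exact hp.mono (by linarith)
      · exact fun m => (hp m).trans (by linarith)
  have hle : 1 - 3 * α + η < s → TwoAgents fun a => Fav h (pairCuts i j α s) (ζ + η) a j :=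
    fun h1 => (hs.two_le h1).imp fun a ha hf => by
      rcases hpass a ha with hp | hp
      · exact fun m => (hp m).trans (by linarith)
      · exact hp.mono (by linarith)
  rcases lt_or_ge (1 - 3 * α + η) s with h1 | h1 <;> rcases lt_or_ge s (α - η) with h2 | h2
  · obtain ⟨s', hs', a, ha, hai, haj⟩ := hfail i j hij
    have hss := H.abs_med_sub_le hij hη hαα hs hs'
    have hc : ∀ q, |pairLen i j α' s' q - pairLen i j α s q| ≤ |s' - s| + 2 * η := by
      intro q
      have e1 := le_abs_self (s' - s)
      have e2 := neg_abs_le (s' - s)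
      unfold pairLen
      split_ifs <;> rw [abs_le] <;> constructor <;> linarith
    obtain ⟨m, hm⟩ := exists_fav h (pairCuts i j α' s') a
    have hmθ : Fav h (pairCuts i j α s) θ a m := by
      refine H.fav_of_len_close hc ?_ hm
      refine le_of_mul_le_mul_left (a := κ ^ 2) ?_ (by positivity)
      nlinarith [S.le_θ]
    have hζθ : ζ + η ≤ θ := by nlinarith [S.ζ_le, S.θ_nonneg]
    have hξ := S.ξ_nonneg
    obtain ⟨g, g0, hg⟩ := matched_pair (F := fun a m => Fav h (pairCuts i j α s) θ a m) hij
      (fun a => (exists_fav h _ a).imp fun m hf => hf.mono S.θ_nonneg)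
      ((hge h2).imp fun a _ hf => hf.mono hζθ) ((hle h1).imp fun a _ hf => hf.mono hζθ)
      ⟨a, ha, m, fun e => hai (e ▸ hm.mono hξ), fun e => haj (e ▸ hm.mono hξ), hmθ⟩
    refine ⟨g, fun a => ?_⟩
    by_cases ha : a = 0
    · subst ha
      intro m
      have hθ := S.θ_nonneg
      rw [not_or] at g0
      simp only [pairCuts, H.piece_zero, pairLen, if_neg g0.1, if_neg g0.2]
      split_ifs <;> linarith
    · exact hg a ha
  · exact H.exists_perm_of_near_corner S hα' (hcj h2) (hle h1) hfail
  · exact H.exists_perm_of_near_corner S hα' (hci h1) (hge h2) hfail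
  · -- Here `α` is near `1 / 4` and both corners are near; two agents agree on `i` or on `j`.
    by_cases hi : TwoAgents fun a => Fav h (pairCuts i j α s) ζ a i
    · exact H.exists_perm_of_near_corner S hα' (hci h1)
        (hi.imp fun a _ hf => hf.mono (by linarith)) hfail
    · refine H.exists_perm_of_near_corner S hα' (hcj h2)
        ((twoAgents_not_of_not hi).imp fun a ha hf => ?_) hfail
      exact ((hpass a ha).resolve_left hf).mono (by linarith)

theorem pairCuts_quarter {i j i' j' : Fin 4} {s s' : ℝ} (hs : IsMed h η i j (1 / 4) s)
    (hs' : IsMed h η i' j' (1 / 4) s') : pairCuts i j (1 / 4) s = pairCuts i' j' (1 / 4) s' := by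
  have e1 := hs.ge
  have e2 := hs.le
  have e3 := hs'.ge
  have e4 := hs'.le
  unfold pairCuts
  congr 1
  funext q
  unfold pairLen
  split_ifs <;> linarith

/-- At the lowest level the division is into pieces of equal length; it is envy-free unless some
pair attracts all agents. -/
theorem BiLip.exists_perm_of_failsAt_quarter (H : BiLip κ h) (hξ : 0 ≤ ξ)
    (hfail : FailsAt h η ξ (1 / 4)) {i j : Fin 4} {s : ℝ} (hs : IsMed h η i j (1 / 4) s) :
    ∃ g : Equiv.Perm (Fin 4), ∀ a, Fav h (pairCuts i j (1 / 4) s) 0 a (g a) := by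
  -- A choice of favourites takes three different values, or else a pair attracts everybody.
  obtain ⟨f, hf⟩ := Classical.axiomOfChoice (exists_fav h (pairCuts i j (1 / 4) s))
  have no : ∀ k m : Fin 4, k ≠ m → ∃ a, a ≠ 0 ∧ f a ≠ k ∧ f a ≠ m := by
    intro k m hkm
    obtain ⟨s', hs', a, ha, hk, hm⟩ := hfail k m hkm
    rw [← pairCuts_quarter hs hs'] at hk hm
    exact ⟨a, ha, fun e => hk (e ▸ (hf a).mono hξ), fun e => hm (e ▸ (hf a).mono hξ)⟩
  have hne : ∀ a b c : Fin 4, a ≠ 0 → b ≠ 0 → c ≠ 0 → a ≠ b → a ≠ c → b ≠ c → f a ≠ f b := by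
    intro a b c ha hb hc hab hac hbc e
    obtain ⟨m, hm, hm'⟩ : ∃ m, f a ≠ m ∧ (f c = f a ∨ f c = m) := by
      by_cases e' : f c = f a
      · obtain ⟨m, hm⟩ := exists_ne (f a)
        exact ⟨m, hm.symm, Or.inl e'⟩
      · exact ⟨f c, Ne.symm e', Or.inr rfl⟩
    obtain ⟨d, hd, h1, h2⟩ := no (f a) m hm
    rcases eq_or_eq_or_eq_of_ne_zero ha hb hc hab hac hbc hd with rfl | rfl | rfl
    · exact h1 rfl
    · exact h1 e.symm
    · exact hm'.elim h1 h2
  obtain ⟨g, g1, g2, g3⟩ := exists_perm_of_three (b := 1) (c := 2) (d := 3) (by decide) (by decide)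
    (by decide) (by decide) (by decide) (by decide)
    (hne 1 2 3 (by decide) (by decide) (by decide) (by decide) (by decide) (by decide))
    (hne 1 3 2 (by decide) (by decide) (by decide) (by decide) (by decide) (by decide))
    (hne 2 3 1 (by decide) (by decide) (by decide) (by decide) (by decide) (by decide))
  refine ⟨g, fun a => ?_⟩
  by_cases ha : a = 0
  · subst ha
    intro m
    have e1 := hs.ge
    have e2 := hs.le
    simp only [pairCuts, H.piece_zero, pairLen]
    split_ifs <;> linarith
  · rcases eq_or_eq_or_eq_of_ne_zero (b := 1) (c := 2) (d := 3) (by decide) (by decide) (by decide)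
      (by decide) (by decide) (by decide) ha with rfl | rfl | rfl
    · exact g1 ▸ hf 1
    · exact g2 ▸ hf 2
    · exact g3 ▸ hf 3

/-- At the highest level the pieces of the pair are empty. -/
theorem BiLip.failsAt_half (H : BiLip κ h) (hη : 0 ≤ η) (hξ : ξ < κ / 2) :
    FailsAt h η ξ (1 / 2) := by
  intro i j hij
  have hz : ∀ k, k = i ∨ k = j → ∀ a, piece h (pairCuts i j (1 / 2) 0) a k = 0 := by
    intro k hk a
    have := cutsOf_succ_sub (pairLen i j (1 / 2) 0) k
    have h0 : pairLen i j (1 / 2) 0 k = 0 := by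
      unfold pairLen
      rcases hk with rfl | rfl
      · simp
      · simp
    rw [h0, sub_eq_zero] at this
    rw [piece, pairCuts, this, sub_self]
  have hzi := hz i (Or.inl rfl)
  have hzj := hz j (Or.inr rfl)
  obtain ⟨m, hmi, hmj⟩ : ∃ m : Fin 4, m ≠ i ∧ m ≠ j := by
    clear hz hzi hzj; revert i j; decide
  have hm : κ / 2 ≤ piece h (pairCuts i j (1 / 2) 0) 1 m := by
    have h1 := cutsOf_succ_sub (pairLen i j (1 / 2) 0) m
    have h2 : pairLen i j (1 / 2) 0 m = 1 / 2 := by simp [pairLen, hmi, hmj]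
    rw [h2] at h1
    have h3 := H.lower 1 (cutsOf (pairLen i j (1 / 2) 0) m.castSucc)
      (cutsOf (pairLen i j (1 / 2) 0) m.succ) (by linarith)
    rw [h1] at h3
    unfold piece pairCuts
    linarith
  have two : TwoAgents fun _ => (0 : ℝ) ≤ 0 + η :=
    ⟨1, 2, by decide, by decide, by decide, by linarith, by linarith⟩
  refine ⟨0, ⟨by norm_num, by norm_num, fun _ => ?_, fun _ => ?_⟩, 1, by decide, ?_, ?_⟩
  · simp only [hzi, hzj]; exact two
  · simp only [hzi, hzj]; exact two
  · intro hf
    have := hf m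
    rw [hzi] at this
    linarith
  · intro hf
    have := hf m
    rw [hzj] at this
    linarith

end

/-! ### Locating the median -/

/-- A monotone test on pairs of points at distance `γ` has a threshold. Off the diagonal the test
is determined only to the lower left and to the upper right of it. -/
theorem exists_target {P : ℝ → ℝ → Prop} (hP : ∀ x y x' y', x ≤ x' → y ≤ y' → P x y → P x' y')
    {γ : ℝ} (hγ1 : γ ≤ 1) :
    ∃ z, 0 ≤ z ∧ z + γ ≤ 1 ∧ ∀ x y, 0 ≤ x → y ≤ 1 →
      (x < z → y < z + γ → ¬ P x y) ∧ (z < x → z + γ < y → P x y) := by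
  set S : Set ℝ := {x | (0 ≤ x ∧ P x (x + γ)) ∨ x = 1 - γ} with hS
  have hne : (1 - γ) ∈ S := Or.inr rfl
  have hb : ∀ x ∈ S, 0 ≤ x := by
    rintro x (h | h)
    · exact h.1
    · linarith
  have hbdd : BddBelow S := ⟨0, hb⟩
  have hz1 : sInf S ≤ 1 - γ := csInf_le hbdd hne
  refine ⟨sInf S, le_csInf ⟨_, hne⟩ hb, by linarith, fun x y hx hy => ⟨fun h1 h2 hp => ?_,
    fun h1 h2 => ?_⟩⟩
  · have hw : max x (y - γ) ∈ S := Or.inl ⟨hx.trans (le_max_left _ _),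
      hP _ _ _ _ (le_max_left _ _) (by linarith [le_max_right x (y - γ)]) hp⟩
    have := csInf_le hbdd hw
    have := max_lt h1 (show y - γ < sInf S by linarith)
    linarith
  · obtain ⟨w, hw, hw'⟩ := exists_lt_of_csInf_lt ⟨_, hne⟩
      (lt_min h1 (show sInf S < y - γ by linarith))
    obtain ⟨w1, w2⟩ := lt_min_iff.1 hw'
    rcases hw with h | h
    · exact hP _ _ _ _ w1.le (by linarith) h.2
    · linarith

theorem pairCuts_of_lt {i j : Fin 4} (hij : i < j) (α s : ℝ) :
    pairCuts i j α s i.castSucc = (i : ℕ) * α ∧ pairCuts i j α s i.succ = (i : ℕ) * α + s ∧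
    pairCuts i j α s j.castSucc = (i : ℕ) * α + s + ((j : ℕ) - (i : ℕ) - 1) * α ∧
    pairCuts i j α s j.succ = 1 - (3 - (j : ℕ)) * α := by
  fin_cases i <;> fin_cases j <;> first | exact absurd hij (by decide) | skip
  all_goals
    refine ⟨?_, ?_, ?_, ?_⟩ <;> simp [pairCuts, cutsOf, pairLen, Fin.sum_univ_four] <;>
      first | ring1 | (left; ring1)

/-- The predicate that drives the search for the median of the pair `i < j`: two agents like the
piece ending at `x` at least as much as the piece starting at `y`. Here `l` and `r` are (nearly)
the values of `[0, L]` and `[0, R]`, where `L` is the left end of piece `i` and `R` is the right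
end of piece `j`. -/
def LeftPreferred (l r p q : Fin 4 → ℝ) : Prop := TwoAgents fun a => l a + r a ≤ p a + q a

theorem LeftPreferred.mono {l r p q p' q' : Fin 4 → ℝ} (hp : ∀ a, p a ≤ p' a)
    (hq : ∀ a, q a ≤ q' a) (H : LeftPreferred l r p q) : LeftPreferred l r p' q' :=
  TwoAgents.imp H fun a _ h => h.trans (add_le_add (hp a) (hq a))

/-- The parameter obtained from the approximate position `x` of the right end of piece `i`. -/
noncomputable def clampParam (i : Fin 4) (α x : ℝ) : ℝ :=
  max (max 0 (1 - 3 * α)) (min (min α (1 - 2 * α)) (x - (i : ℕ) * α))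

theorem clampParam_mem {i : Fin 4} {α x : ℝ} (h1 : 1 / 4 ≤ α) (h2 : α ≤ 1 / 2) :
    0 ≤ clampParam i α x ∧ 1 - 3 * α ≤ clampParam i α x ∧ clampParam i α x ≤ α ∧
    clampParam i α x ≤ 1 - 2 * α := by
  unfold clampParam
  refine ⟨(le_max_left _ _).trans (le_max_left _ _), (le_max_right _ _).trans (le_max_left _ _),
    max_le (max_le ?_ ?_) ((min_le_left _ _).trans (min_le_left _ _)),
    max_le (max_le ?_ ?_) ((min_le_left _ _).trans (min_le_right _ _))⟩ <;> linarith

/-- A search with the predicate `LeftPreferred` yields an approximate median. -/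
theorem BiLip.isMed_clampParam {κ η e : ℝ} {h : Fin 4 → ℝ → ℝ} (H : BiLip κ h) (he : 0 < e)
    (heη : 10 * e ≤ κ * η) {i j : Fin 4} (hij : i < j) {α : ℝ} (hα1 : 1 / 4 ≤ α) (hα2 : α ≤ 1 / 2)
    {l r : Fin 4 → ℝ} (hl : ∀ a, κ * |l a - h a ((i : ℕ) * α)| ≤ e)
    (hr : ∀ a, κ * |r a - h a (1 - (3 - (j : ℕ)) * α)| ≤ e) {z x : ℝ}
    (hz : ∀ x y, 0 ≤ x → y ≤ 1 →
      (x < z → y < z + ((j : ℕ) - (i : ℕ) - 1) * α →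
        ¬ LeftPreferred l r (fun a => h a x) fun a => h a y) ∧
      (z < x → z + ((j : ℕ) - (i : ℕ) - 1) * α < y →
        LeftPreferred l r (fun a => h a x) fun a => h a y))
    (hx : |x - z| ≤ e) : IsMed h η i j α (clampParam i α x) := by
  have hκ := H.pos
  obtain ⟨s0, s1, s2, s3⟩ := clampParam_mem (i := i) (x := x) hα1 hα2
  obtain ⟨x1, x2⟩ := abs_le.1 hx
  obtain ⟨c1, c2, c3, c4⟩ := pairCuts_of_lt hij α (clampParam i α x)
  have hsdef : clampParam i α x =
    max (max 0 (1 - 3 * α)) (min (min α (1 - 2 * α)) (x - (i : ℕ) * α)) := rfl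
  set s := clampParam i α x with hs
  set L : ℝ := (i : ℕ) * α with hL
  set R : ℝ := 1 - (3 - (j : ℕ)) * α with hR
  set γ : ℝ := ((j : ℕ) - (i : ℕ) - 1) * α with hγ
  have hi0 : (0 : ℝ) ≤ (i : ℕ) := Nat.cast_nonneg _
  have hj3 : ((j : ℕ) : ℝ) ≤ 3 := by
    have : (j : ℕ) ≤ 3 := by omega
    exact_mod_cast this
  have hij' : ((i : ℕ) : ℝ) + 1 ≤ (j : ℕ) := by exact_mod_cast hij
  have hL0 : 0 ≤ L := mul_nonneg hi0 (by linarith)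
  have hR1 : R ≤ 1 := by
    have : 0 ≤ (3 - ((j : ℕ) : ℝ)) * α := mul_nonneg (by linarith) (by linarith)
    linarith
  have hγ0 : 0 ≤ γ := mul_nonneg (by linarith) (by linarith)
  have hRL : R - (L + s + γ) = 1 - 2 * α - s := by rw [hR, hL, hγ]; ring
  have pi : ∀ a, piece h (pairCuts i j α s) a i = h a (L + s) - h a L := fun a => by
    rw [piece, c1, c2]
  have pj : ∀ a, piece h (pairCuts i j α s) a j = h a R - h a (L + s + γ) := fun a => by
    rw [piece, c3, c4]
  have pi0 : ∀ a, 0 ≤ h a (L + s) - h a L := fun a => by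
    linarith [H.mono a (show L ≤ L + s by linarith)]
  have pj0 : ∀ a, 0 ≤ h a R - h a (L + s + γ) := fun a => by
    linarith [H.mono a (show L + s + γ ≤ R by linarith)]
  refine ⟨s1, s2, fun hlt => ?_, fun hlt => ?_⟩
  · by_contra hcon
    have hno := twoAgents_not_of_not hcon
    simp only [pi, pj, not_le] at hno
    have hs4 : ¬ s < 4 * e := by
      intro h4
      obtain ⟨a, -, -, -, -, ha, -⟩ := hno
      have h5 := H.upper a L (L + s) (by linarith)
      have h6 := pj0 a
      have h7 : κ * η < κ * (h a (L + s) - h a L) := mul_lt_mul_of_pos_left (by linarith) hκ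
      linarith
    -- Two agents strictly prefer piece `i`, even after it is shortened by `4 * e`; so the
    -- threshold lies to the left, and only clamping can have produced `s`.
    have hP : LeftPreferred l r (fun a => h a (L + s - 4 * e)) fun a => h a (L + s + γ - 4 * e) := by
      refine hno.imp fun a _ ha => ?_
      have h5 := H.upper a (L + s - 4 * e) (L + s) (by linarith)
      have h6 := H.upper a (L + s + γ - 4 * e) (L + s + γ) (by linarith)
      have h7 := mul_le_mul_of_nonneg_left (le_abs_self (l a - h a L)) hκ.le
      have h8 := mul_le_mul_of_nonneg_left (le_abs_self (r a - h a R)) hκ.le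
      have h9 := mul_lt_mul_of_pos_left ha hκ
      have := hl a
      have := hr a
      refine le_of_mul_le_mul_left ?_ hκ
      linarith
    have hzw : z ≤ L + s - 4 * e := by
      by_contra! hzw
      exact (hz (L + s - 4 * e) (L + s + γ - 4 * e) (by linarith) (by linarith)).1 hzw
        (by linarith) hP
    have : s ≤ max 0 (1 - 3 * α) := by
      by_contra! h5
      have h6 : s ≤ min (min α (1 - 2 * α)) (x - L) := by
        rw [hsdef] at h5 ⊢
        exact (max_le_iff.2 ⟨((lt_max_iff.1 h5).resolve_left (lt_irrefl _)).le, le_rfl⟩)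
      have := h6.trans (min_le_right _ _)
      linarith
    rcases le_max_iff.1 this with h5 | h5
    · exact hs4 (by linarith)
    · have : 0 ≤ η := by
        by_contra! h6
        nlinarith
      linarith
  · by_contra hcon
    have hno := twoAgents_not_of_not hcon
    simp only [pi, pj, not_le] at hno
    have hs4 : ¬ 1 - 2 * α - s < 4 * e := by
      intro h4
      obtain ⟨a, -, -, -, -, ha, -⟩ := hno
      have h5 := H.upper a (L + s + γ) R (by linarith)
      have h6 := pi0 a
      have h7 : κ * η < κ * (h a R - h a (L + s + γ)) := mul_lt_mul_of_pos_left (by linarith) hκ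
      linarith
    -- Two agents strictly prefer piece `j`, even after it is shortened by `4 * e`.
    have hP : ¬ LeftPreferred l r (fun a => h a (L + s + 4 * e))
        fun a => h a (L + s + γ + 4 * e) := by
      intro hP
      obtain ⟨a, -, ha, hb⟩ := hno.exists_both hP
      have h5 := H.upper a (L + s) (L + s + 4 * e) (by linarith)
      have h6 := H.upper a (L + s + γ) (L + s + γ + 4 * e) (by linarith)
      have h7 := mul_le_mul_of_nonneg_left (neg_abs_le (l a - h a L)) hκ.le
      have h8 := mul_le_mul_of_nonneg_left (neg_abs_le (r a - h a R)) hκ.le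
      have h9 := mul_lt_mul_of_pos_left ha hκ
      have h10 := mul_le_mul_of_nonneg_left hb hκ.le
      have := hl a
      have := hr a
      linarith
    have hzw : L + s + 4 * e ≤ z := by
      by_contra! hzw
      exact hP ((hz (L + s + 4 * e) (L + s + γ + 4 * e) (by linarith) (by linarith)).2 hzw
        (by linarith))
    have h5 : min (min α (1 - 2 * α)) (x - L) ≤ s := by
      rw [hsdef]; exact le_max_right _ _
    have hη : 0 ≤ η := by
      by_contra! h6
      nlinarith
    rcases min_le_iff.1 h5 with h6 | h6
    · rcases min_le_iff.1 h6 with h7 | h7 <;> [linarith; exact hs4 (by linarith)]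
    · linarith

/-! ### Additive valuations -/

namespace IsAdditiveValuation

variable {v : I → I → ℝ}

theorem eq_sub (hv : IsAdditiveValuation v) {x y : I} (hxy : x ≤ y) : v x y = v 0 y - v 0 x := by
  obtain ⟨f, -, hf, hvf⟩ := hv.exists_density
  have hint : ∀ a b : I, a ≤ b → IntervalIntegrable f volume a b := fun a b hab =>
    (intervalIntegrable_iff_integrableOn_Icc_of_le hab).2
      (hf.mono_set (Set.Icc_subset_Icc a.2.1 b.2.2))
  rw [hvf x y hxy, hvf 0 y y.2.1, hvf 0 x x.2.1, eq_sub_iff_add_eq',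
    intervalIntegral.integral_add_adjacent_intervals (hint 0 x x.2.1) (hint x y hxy)]

theorem nonneg (hv : IsAdditiveValuation v) (x y : I) : 0 ≤ v x y := by
  obtain ⟨f, hf0, -, hvf⟩ := hv.exists_density
  rcases le_total x y with h | h
  · rw [hvf x y h]
    exact intervalIntegral.integral_nonneg h fun t ht => hf0 t ⟨x.2.1.trans ht.1, ht.2.trans y.2.2⟩
  · rw [hv.eq_zero x y h]

theorem monotone (hv : IsAdditiveValuation v) : Monotone (v 0) := fun x y hxy => by
  have := hv.nonneg x y
  rw [hv.eq_sub hxy] at this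
  linarith

theorem zero_zero (hv : IsAdditiveValuation v) : v 0 0 = 0 := hv.eq_zero 0 0 le_rfl

theorem continuous (hv : IsAdditiveValuation v) : Continuous (v 0) := by
  obtain ⟨f, -, hf, hvf⟩ := hv.exists_density
  have h1 : ContinuousOn (fun t => ∫ x in (0 : ℝ)..t, f x) (Set.Icc 0 1) := by
    have := intervalIntegral.continuousOn_primitive_interval (a := 0) (b := 1) (f := f)
      (μ := volume) (by rwa [Set.uIcc_of_le zero_le_one])
    rwa [Set.uIcc_of_le zero_le_one] at this
  have h2 : v 0 = fun x : I => ∫ t in (0 : ℝ)..x, f t := by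
    funext x
    exact hvf 0 x x.2.1
  rw [h2]
  exact continuousOn_iff_continuous_domRestrict.1 h1

end IsAdditiveValuation

/-- The value of `[0, x]` under the valuation of agent `a` mixed with a portion `δ` of the average
valuation. -/
noncomputable def mix (δ : ℝ) (p : Fin 4 → ℝ) (a : Fin 4) : ℝ :=
  (1 - δ) * p a + δ * ((∑ i, p i) / 4)

section
variable {v : Fin 4 → I → I → ℝ} {δ : ℝ}

theorem mix_sub_mix (δ : ℝ) (p q : Fin 4 → ℝ) (a : Fin 4) :
    mix δ p a - mix δ q a = (1 - δ) * (p a - q a) + δ * ((∑ i, (p i - q i)) / 4) := by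
  rw [Finset.sum_sub_distrib]; unfold mix; ring

theorem mix_nonneg_le (hδ0 : 0 ≤ δ) (hδ1 : δ ≤ 1) {p : Fin 4 → ℝ} (hp : ∀ i, 0 ≤ p i)
    (a : Fin 4) : δ / 4 * (∑ i, p i) ≤ (1 - δ) * p a + δ * ((∑ i, p i) / 4) ∧
      (1 - δ) * p a + δ * ((∑ i, p i) / 4) ≤ ∑ i, p i := by
  have h1 : p a ≤ ∑ i, p i := Finset.single_le_sum (fun i _ => hp i) (Finset.mem_univ a)
  have h2 := hp a
  have h3 : 0 ≤ ∑ i, p i := Finset.sum_nonneg fun i _ => hp i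
  constructor <;> nlinarith

theorem mix_monotone (hv : ∀ i, IsAdditiveValuation (v i)) (hδ0 : 0 ≤ δ) (hδ1 : δ ≤ 1)
    (a : Fin 4) : Monotone fun x => mix δ (fun i => v i 0 x) a := fun x y hxy => by
  have hp : ∀ i, 0 ≤ v i 0 y - v i 0 x := fun i => by linarith [(hv i).monotone hxy]
  have h1 := (mix_nonneg_le hδ0 hδ1 hp a).1
  have h2 := mix_sub_mix δ (fun i => v i 0 y) (fun i => v i 0 x) a
  have h3 : 0 ≤ ∑ i, (v i 0 y - v i 0 x) := Finset.sum_nonneg fun i _ => hp i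
  have h4 : 0 ≤ δ / 4 * ∑ i, (v i 0 y - v i 0 x) := by positivity
  simp only at h2 ⊢
  linarith

/-- In the coordinate of agent `0`, the mixed valuations have slopes between `δ / 4` and `4 / δ`. -/
theorem exists_biLip (hv : ∀ i, IsAdditiveValuation (v i)) (hδ0 : 0 < δ) (hδ1 : δ ≤ 1) :
    ∃ h : Fin 4 → ℝ → ℝ, BiLip (δ / 4) h ∧
      ∀ a x, h a (mix δ (fun i => v i 0 x) 0) = mix δ (fun i => v i 0 x) a := by
  set u : Fin 4 → I → ℝ := fun a x => mix δ (fun i => v i 0 x) a with hu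
  have u0 : ∀ a, u a 0 = 0 := fun a => by simp [hu, mix, (hv _).zero_zero]
  have u1 : ∀ a, u a 1 = 1 := fun a => by simp [hu, mix, (hv _).total]
  have slope : ∀ a x y, x ≤ y → δ / 4 * (u 0 y - u 0 x) ≤ u a y - u a x ∧
      δ / 4 * (u a y - u a x) ≤ u 0 y - u 0 x := by
    intro a x y hxy
    have hp : ∀ i, 0 ≤ v i 0 y - v i 0 x := fun i => by linarith [(hv i).monotone hxy]
    have e := fun a => mix_nonneg_le hδ0.le hδ1 hp a
    simp only [hu, mix_sub_mix]
    have h4 : 0 ≤ δ / 4 := by positivity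
    exact ⟨(mul_le_mul_of_nonneg_left (e 0).2 h4).trans (e a).1,
      (mul_le_mul_of_nonneg_left (e a).2 h4).trans (e 0).1⟩
  have slope' : ∀ a x y, u 0 x ≤ u 0 y → δ / 4 * (u 0 y - u 0 x) ≤ u a y - u a x ∧
      δ / 4 * (u a y - u a x) ≤ u 0 y - u 0 x := by
    intro a x y hxy
    rcases le_total x y with h | h
    · exact slope a x y h
    · have e0 : u 0 x = u 0 y := le_antisymm hxy (mix_monotone hv hδ0.le hδ1 0 h)
      obtain ⟨h1, h2⟩ := slope a y x h
      have h3 := mix_monotone hv hδ0.le hδ1 a h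
      have e1 : u a x = u a y := by
        refine le_antisymm ?_ h3
        have : δ / 4 * (u a x - u a y) ≤ 0 := by linarith
        have := nonpos_of_mul_nonpos_right this (by positivity)
        linarith
      rw [e0, e1]; simp
  -- A point `x` is determined by `u 0 x` up to pieces of value `0` to everybody, so `u a` is a
  -- function of `u 0`; beyond `[0, 1]` it is continued with slope `1`.
  have surj : ∀ t : I, ∃ x, u 0 x = t := by
    intro t
    have hc : Continuous (u 0) := by
      simp only [hu, mix]
      have := fun i => (hv i).continuous
      fun_prop
    obtain ⟨x, hx⟩ := mem_range_of_exists_le_of_exists_ge hc ⟨0, (u0 0).trans_le t.2.1⟩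
      ⟨1, t.2.2.trans_eq (u1 0).symm⟩
    exact ⟨x, hx⟩
  choose g hg using surj
  have hproj : ∀ x y : ℝ, x ≤ y → 0 ≤ ((Set.projIcc 0 1 zero_le_one y : I) : ℝ)
      - (Set.projIcc 0 1 zero_le_one x : I) ∧ ((Set.projIcc 0 1 zero_le_one y : I) : ℝ)
      - (Set.projIcc 0 1 zero_le_one x : I) ≤ y - x := by
    intro x y hxy
    simp only [Set.coe_projIcc]
    constructor <;> rcases max_cases (0 : ℝ) (min 1 y) with h1 | h1 <;>
      rcases max_cases (0 : ℝ) (min 1 x) with h2 | h2 <;>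
      rcases min_cases 1 y with h3 | h3 <;> rcases min_cases 1 x with h4 | h4 <;> linarith
  refine ⟨fun a t => u a (g (Set.projIcc 0 1 zero_le_one t)) +
    (t - (Set.projIcc 0 1 zero_le_one t : I)), ⟨by positivity, by linarith, ?_, ?_, ?_⟩, ?_⟩
  · intro a x y hxy
    obtain ⟨p1, p2⟩ := hproj x y hxy
    have h1 := (slope' a (g (Set.projIcc 0 1 zero_le_one x)) (g (Set.projIcc 0 1 zero_le_one y))
      (by rw [hg, hg]; linarith)).1
    rw [hg, hg] at h1
    nlinarith
  · intro a x y hxy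
    obtain ⟨p1, p2⟩ := hproj x y hxy
    have h1 := (slope' a (g (Set.projIcc 0 1 zero_le_one x)) (g (Set.projIcc 0 1 zero_le_one y))
      (by rw [hg, hg]; linarith)).2
    rw [hg, hg] at h1
    nlinarith
  · intro x
    simp [hg]
  · intro a x
    have hx : u 0 x ∈ I := ⟨(u0 0).symm.trans_le (mix_monotone hv hδ0.le hδ1 0 x.2.1),
      (mix_monotone hv hδ0.le hδ1 0 x.2.2).trans_eq (u1 0)⟩
    have hpx : Set.projIcc 0 1 zero_le_one (u 0 x) = (⟨u 0 x, hx⟩ : I) :=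
      Set.projIcc_of_mem zero_le_one hx
    change u a (g (Set.projIcc 0 1 zero_le_one (u 0 x))) +
      (u 0 x - (Set.projIcc 0 1 zero_le_one (u 0 x) : I)) = u a x
    rw [hpx]
    simp only [sub_self, add_zero]
    have e0 : u 0 (g ⟨u 0 x, hx⟩) = u 0 x := hg _
    obtain ⟨h1, h2⟩ := slope' a x (g ⟨u 0 x, hx⟩) e0.ge
    rw [e0] at h1 h2
    have h3 := nonpos_of_mul_nonpos_right (h2.trans_eq (sub_self _)) (by positivity)
    linarith

end

/-! ### Subroutines -/

/-- A subroutine that computes an element of `β` by queries, in continuation-passing form: given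
what to do with the result, it is a protocol. -/
def Subroutine (β : Type) : Type := (β → RWProtocol 4) → RWProtocol 4

namespace Subroutine

variable {β β' : Type}

/-- The subroutine that returns `b` without a query. -/
def pure (b : β) : Subroutine β := fun k => k b

/-- Sequential composition. -/
def bind (s : Subroutine β) (f : β → Subroutine β') : Subroutine β' := fun k => s fun b => f b k

/-- Runs finitely many subroutines one after the other and collects the results. -/
def all : {n : ℕ} → (Fin n → Subroutine β) → Subroutine (Fin n → β)
  | 0, _ => pure Fin.elim0
  | _ + 1, f => (f 0).bind fun b => (all fun i => f i.succ).bind fun bs => pure (Fin.cons b bs)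

/-- On the valuations `v`, every execution of `s` makes at most `N` queries and returns a result
satisfying `Q`. -/
def Realizes (v : Fin 4 → I → I → ℝ) (s : Subroutine β) (N : ℕ) (Q : β → Prop) : Prop :=
  ∀ k q A, RWProtocol.Run v (s k) q A → ∃ b q', Q b ∧ RWProtocol.Run v (k b) q' A ∧ q ≤ q' + N

variable {v : Fin 4 → I → I → ℝ}

theorem Realizes.pure {b : β} {Q : β → Prop} (hb : Q b) : Realizes v (pure b) 0 Q :=
  fun _ q _ h => ⟨b, q, hb, h, by simp⟩

theorem Realizes.bind {s : Subroutine β} {f : β → Subroutine β'} {N M : ℕ} {Q : β → Prop}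
    {R : β' → Prop} (hs : Realizes v s N Q) (hf : ∀ b, Q b → Realizes v (f b) M R) :
    Realizes v (s.bind f) (N + M) R := by
  intro k q A h
  obtain ⟨b, q', hb, h', hq⟩ := hs _ q A h
  obtain ⟨c, q'', hc, h'', hq'⟩ := hf b hb _ q' A h'
  exact ⟨c, q'', hc, h'', by omega⟩

theorem Realizes.mono {s : Subroutine β} {N M : ℕ} {Q R : β → Prop} (hs : Realizes v s N Q)
    (hNM : N ≤ M) (hQR : ∀ b, Q b → R b) : Realizes v s M R := by
  intro k q A h
  obtain ⟨b, q', hb, h', hq⟩ := hs k q A h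
  exact ⟨b, q', hQR b hb, h', by omega⟩

theorem Realizes.all {N : ℕ} : ∀ {n : ℕ} {f : Fin n → Subroutine β} {Q : Fin n → β → Prop},
    (∀ i, Realizes v (f i) N (Q i)) → Realizes v (all f) (n * N) fun bs => ∀ i, Q i (bs i)
  | 0, f, Q, _ => (Realizes.pure (b := Fin.elim0) fun i => i.elim0).mono (by simp) fun _ h => h
  | n + 1, f, Q, h => by
    refine Realizes.mono ((h 0).bind (M := n * N + 0) fun b hb =>
      (Realizes.all fun i => h i.succ).bind fun bs hbs => Realizes.pure ?_) (by lia) fun _ h => h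
    intro i
    refine Fin.cases ?_ (fun i => ?_) i
    · simpa using hb
    · simpa using hbs i

end Subroutine

open Subroutine

/-- Asks agent `i` for the value of `[0, x]`. -/
def askValue (x : I) (i : Fin 4) : Subroutine ℝ := fun k => .value i 0 x k

/-- Asks all agents for the value of `[0, x]`. -/
def probe (x : I) : Subroutine (Fin 4 → ℝ) := all (askValue x)

/-- The total value of `[a, b]` to all agents. -/
noncomputable def width (v : Fin 4 → I → I → ℝ) (a b : I) : ℝ := ∑ i, (v i 0 b - v i 0 a)

/-- Asks an agent who values `[a, b]` most to halve it. The reply is forced into `[a, b]`, which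
matters only if the agent, and hence everybody, values `[a, b]` at `0`. -/
noncomputable def splitPoint (a b : I) : Subroutine I :=
  (probe a).bind fun p => (probe b).bind fun q => fun k =>
    let i := Classical.choose (Finite.exists_max fun i => q i - p i)
    .cut i a ((q i - p i) / 2) fun o => k (max a (min (o.getD a) b))

section
variable {v : Fin 4 → I → I → ℝ}

theorem realizes_probe (x : I) : Realizes v (probe x) 4 fun p => p = fun i => v i 0 x := by
  refine (Realizes.all (N := 1) (Q := fun i b => b = v i 0 x) fun i => ?_).mono (by simp)
    fun p hp => funext hp
  intro k q A h
  cases h with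
  | value _ _ _ _ q _ h => exact ⟨_, q, rfl, h, le_rfl⟩

theorem width_nonneg (hv : ∀ i, IsAdditiveValuation (v i)) {a b : I} (hab : a ≤ b) :
    0 ≤ width v a b :=
  Finset.sum_nonneg fun i _ => sub_nonneg.2 ((hv i).monotone hab)

/-- Splitting at the halving point of the agent with the largest value removes an eighth of the
total value from either side. -/
theorem realizes_splitPoint (hv : ∀ i, IsAdditiveValuation (v i)) {a b : I} (hab : a ≤ b) :
    Realizes v (splitPoint a b) 9 fun m => a ≤ m ∧ m ≤ b ∧
      8 * width v a m ≤ 7 * width v a b ∧ 8 * width v m b ≤ 7 * width v a b := by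
  refine (realizes_probe a).bind (M := 4 + 1) fun p hp =>
    (realizes_probe b).bind fun q hq => ?_
  subst hp hq
  intro k n A h
  have hmax := Classical.choose_spec (Finite.exists_max fun i => v i 0 b - v i 0 a)
  set i := Classical.choose (Finite.exists_max fun i => v i 0 b - v i 0 a) with hi
  have hnn : ∀ j, 0 ≤ v j 0 b - v j 0 a := fun j => sub_nonneg.2 ((hv j).monotone hab)
  have hw : width v a b ≤ 4 * (v i 0 b - v i 0 a) := by
    calc width v a b ≤ ∑ _j : Fin 4, (v i 0 b - v i 0 a) := Finset.sum_le_sum fun j _ => hmax j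
      _ = 4 * (v i 0 b - v i 0 a) := by simp; ring
  -- Any point of `[a, b]` that halves the value of agent `i` will do.
  have good : ∀ m : I, a ≤ m → m ≤ b →
      v i 0 m - v i 0 a = (v i 0 b - v i 0 a) / 2 → a ≤ m ∧ m ≤ b ∧
      8 * width v a m ≤ 7 * width v a b ∧ 8 * width v m b ≤ 7 * width v a b := by
    intro m ham hmb hm
    have h1 : ∀ j, 0 ≤ v j 0 m - v j 0 a := fun j => sub_nonneg.2 ((hv j).monotone ham)
    have h2 : ∀ j, 0 ≤ v j 0 b - v j 0 m := fun j => sub_nonneg.2 ((hv j).monotone hmb)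
    have h3 : v i 0 m - v i 0 a ≤ width v a m :=
      Finset.single_le_sum (f := fun j => v j 0 m - v j 0 a) (fun j _ => h1 j) (Finset.mem_univ i)
    have h4 : v i 0 b - v i 0 m ≤ width v m b :=
      Finset.single_le_sum (f := fun j => v j 0 b - v j 0 m) (fun j _ => h2 j) (Finset.mem_univ i)
    have h5 : width v a m + width v m b = width v a b := by
      unfold width
      rw [← Finset.sum_add_distrib]
      exact Finset.sum_congr rfl fun j _ => by ring
    exact ⟨ham, hmb, by linarith, by linarith⟩
  cases h with
  | cut_some _ _ _ _ n _ y hy h =>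
    refine ⟨_, n, ?_, h, le_rfl⟩
    simp only [Option.getD_some]
    have hc1 : a ≤ max a (min y b) := le_max_left _ _
    have hc2 : max a (min y b) ≤ b := max_le hab (min_le_right _ _)
    refine good _ hc1 hc2 ?_
    rcases (hnn i).eq_or_lt with h0 | h0
    · have h1 := (hv i).monotone hc1
      have h2 := (hv i).monotone hc2
      linarith
    · have hay : a < y := by
        by_contra! hya
        rw [(hv i).eq_zero a y hya] at hy
        linarith
      rw [(hv i).eq_sub hay.le] at hy
      have hyb : y ≤ b := by
        by_contra! hby
        have := (hv i).monotone hby.le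
        linarith
      rw [min_eq_left hyb, max_eq_right hay.le]
      exact hy
  | cut_none _ _ _ _ n _ hα h =>
    -- The reply `none` is impossible by the intermediate value theorem.
    exfalso
    obtain ⟨y, hy⟩ := mem_range_of_exists_le_of_exists_ge (hv i).continuous
      (c := v i 0 a + (v i 0 b - v i 0 a) / 2) ⟨a, by linarith [hnn i]⟩ ⟨b, by linarith [hnn i]⟩
    have hle : v i 0 a ≤ v i 0 y := by linarith [hnn i]
    rcases le_total a y with hay | hay
    · refine hα y ?_
      rw [(hv i).eq_sub hay]
      linarith
    · refine hα y ?_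
      rw [(hv i).eq_zero a y hay]
      have := (hv i).monotone hay
      linarith

end

/-! ### The joint search -/

open Classical in
/-- Two intervals `[B 0, B 1]` and `[B 2, B 3]` are split at `m` and `n`; depending on `P` and `Q`,
one side of one of them is discarded. -/
noncomputable def narrow (P Q : Prop) (B : Fin 4 → I) (m n : I) : Fin 4 → I :=
  if P then if Q then ![B 0, B 1, B 2, n] else ![B 0, m, B 2, B 3]
  else if Q then ![m, B 1, B 2, B 3] else ![B 0, B 1, n, B 3]

/-- One step in the search for two points at distance `γ` in the coordinate of agent `0`, known to
lie in `[B 0, B 1]` and `[B 2, B 3]`. Both intervals are split; the test `pos` and the distance at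
the two splitting points tell which part of which interval to discard. -/
noncomputable def searchStep (δ : ℝ) (pos : (Fin 4 → ℝ) → (Fin 4 → ℝ) → Prop) (γ : ℝ)
    (B : Fin 4 → I) : Subroutine (Fin 4 → I) :=
  (splitPoint (B 0) (B 1)).bind fun m => (splitPoint (B 2) (B 3)).bind fun n =>
    (probe m).bind fun p => (probe n).bind fun q =>
      pure (narrow (pos (mix δ p) (mix δ q)) (γ ≤ mix δ q 0 - mix δ p 0) B m n)

/-- Repeats `searchStep`. -/
noncomputable def search (δ : ℝ) (pos : (Fin 4 → ℝ) → (Fin 4 → ℝ) → Prop) (γ : ℝ) :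
    ℕ → (Fin 4 → I) → Subroutine (Fin 4 → I)
  | 0, B => pure B
  | n + 1, B => (searchStep δ pos γ B).bind (search δ pos γ n)

/-- The values at `x` under the mixed valuations. -/
noncomputable def mixAt (δ : ℝ) (v : Fin 4 → I → I → ℝ) (x : I) : Fin 4 → ℝ :=
  mix δ fun i => v i 0 x

/-- The intervals `[B 0, B 1]` and `[B 2, B 3]` contain the points with coordinates `z` and
`z + γ`. -/
structure Brackets (δ : ℝ) (v : Fin 4 → I → I → ℝ) (z γ : ℝ) (B : Fin 4 → I) : Prop where
  le_left : B 0 ≤ B 1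
  le_right : B 2 ≤ B 3
  ge_fst : mixAt δ v (B 0) 0 ≤ z
  fst_le : z ≤ mixAt δ v (B 1) 0
  ge_snd : mixAt δ v (B 2) 0 ≤ z + γ
  snd_le : z + γ ≤ mixAt δ v (B 3) 0

/-- The test `pos` is negative to the lower left of the target `(z, z + γ)` and positive to its
upper right. -/
def Separates (δ : ℝ) (v : Fin 4 → I → I → ℝ) (pos : (Fin 4 → ℝ) → (Fin 4 → ℝ) → Prop)
    (z γ : ℝ) : Prop :=
  ∀ x y : I,
    (mixAt δ v x 0 < z → mixAt δ v y 0 < z + γ → ¬ pos (mixAt δ v x) (mixAt δ v y)) ∧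
    (z < mixAt δ v x 0 → z + γ < mixAt δ v y 0 → pos (mixAt δ v x) (mixAt δ v y))

section
variable {v : Fin 4 → I → I → ℝ} {δ γ z : ℝ} {pos : (Fin 4 → ℝ) → (Fin 4 → ℝ) → Prop}

/-- The target stays in the brackets. For instance, if the test is positive at `(m, n)` and `n` is
too far from `m`, the second target point cannot lie above `n`: then the first would lie above `m`,
and the test would be negative. -/
theorem realizes_searchStep (hv : ∀ i, IsAdditiveValuation (v i)) (hpos : Separates δ v pos z γ)
    {B : Fin 4 → I} (hB : Brackets δ v z γ B) :
    Realizes v (searchStep δ pos γ B) 26 fun B' => Brackets δ v z γ B' ∧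
      8 * (width v (B' 0) (B' 1) * width v (B' 2) (B' 3)) ≤
        7 * (width v (B 0) (B 1) * width v (B 2) (B 3)) := by
  refine (realizes_splitPoint hv hB.le_left).bind (M := 9 + (4 + (4 + 0))) fun m hm =>
    (realizes_splitPoint hv hB.le_right).bind fun n hn => (realizes_probe m).bind fun p hp =>
    (realizes_probe n).bind fun q hq => Realizes.pure ?_
  subst hp hq
  obtain ⟨m1, m2, m3, m4⟩ := hm
  obtain ⟨n1, n2, n3, n4⟩ := hn
  have w1 := width_nonneg hv hB.le_left
  have w2 := width_nonneg hv hB.le_right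
  obtain ⟨b1, b2, b3, b4, b5, b6⟩ := hB
  obtain ⟨p1, p2⟩ := hpos m n
  suffices key : ∀ B', narrow (pos (mixAt δ v m) (mixAt δ v n))
      (γ ≤ mixAt δ v n 0 - mixAt δ v m 0) B m n = B' → Brackets δ v z γ B' ∧
      8 * (width v (B' 0) (B' 1) * width v (B' 2) (B' 3)) ≤
        7 * (width v (B 0) (B 1) * width v (B 2) (B 3)) from key _ rfl
  intro B' hN
  unfold narrow at hN
  split_ifs at hN with h1 h2 h2 <;> subst hN
  · refine ⟨⟨b1, n1, b3, b4, b5, ?_⟩, ?_⟩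
    · by_contra! h3
      change mixAt δ v n 0 < z + γ at h3
      exact p1 (by linarith) h3 h1
    · change 8 * (width v (B 0) (B 1) * width v (B 2) n) ≤ _
      nlinarith
  · refine ⟨⟨m1, b2, b3, ?_, b5, b6⟩, ?_⟩
    · by_contra! h3
      change mixAt δ v m 0 < z at h3
      exact p1 h3 (by linarith) h1
    · change 8 * (width v (B 0) m * width v (B 2) (B 3)) ≤ _
      nlinarith
  · refine ⟨⟨m2, b2, ?_, b4, b5, b6⟩, ?_⟩
    · by_contra! h3
      change z < mixAt δ v m 0 at h3
      exact h1 (p2 h3 (by linarith))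
    · change 8 * (width v m (B 1) * width v (B 2) (B 3)) ≤ _
      nlinarith
  · refine ⟨⟨b1, n2, b3, b4, ?_, b6⟩, ?_⟩
    · by_contra! h3
      change z + γ < mixAt δ v n 0 at h3
      exact h1 (p2 (by linarith) h3)
    · change 8 * (width v (B 0) (B 1) * width v n (B 3)) ≤ _
      nlinarith

theorem realizes_search (hv : ∀ i, IsAdditiveValuation (v i)) (hpos : Separates δ v pos z γ) :
    ∀ (n : ℕ) {B : Fin 4 → I}, Brackets δ v z γ B →
    Realizes v (search δ pos γ n B) (26 * n) fun B' => Brackets δ v z γ B' ∧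
      width v (B' 0) (B' 1) * width v (B' 2) (B' 3) ≤
        (7 / 8) ^ n * (width v (B 0) (B 1) * width v (B 2) (B 3))
  | 0, B, hB => Realizes.pure ⟨hB, by simp⟩
  | n + 1, B, hB => by
    refine Realizes.mono ((realizes_searchStep hv hpos hB).bind (M := 26 * n) fun B' hB' =>
      (realizes_search hv hpos n hB'.1).mono le_rfl fun B'' hB'' => ⟨hB''.1, ?_⟩)
      (by lia) fun _ h => h
    have h1 := mul_le_mul_of_nonneg_left hB'.2 (show (0 : ℝ) ≤ (7 / 8) ^ n by positivity)
    have h2 := hB''.2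
    rw [pow_succ]
    linarith

end

/-- Searches for two points at distance `γ`, starting from the whole cake. Returns a point that
is near one of the two, together with the coordinate of the first of them. -/
noncomputable def approximate (δ e : ℝ) (pos : (Fin 4 → ℝ) → (Fin 4 → ℝ) → Prop) (γ : ℝ) (n : ℕ) :
    Subroutine (I × ℝ) :=
  (search δ pos γ n ![0, 1, 0, 1]).bind fun B => (probe (B 0)).bind fun p =>
    (probe (B 1)).bind fun q => (probe (B 2)).bind fun r => pure <| by
      classical
      exact if ∑ i, (q i - p i) ≤ e then (B 0, mix δ p 0) else (B 2, mix δ r 0 - γ)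

section
variable {v : Fin 4 → I → I → ℝ} {δ γ z e : ℝ} {pos : (Fin 4 → ℝ) → (Fin 4 → ℝ) → Prop} {n : ℕ}

theorem mixAt_zero (hv : ∀ i, IsAdditiveValuation (v i)) (a : Fin 4) : mixAt δ v 0 a = 0 := by
  simp [mixAt, mix, (hv _).zero_zero]

theorem mixAt_one (hv : ∀ i, IsAdditiveValuation (v i)) (a : Fin 4) : mixAt δ v 1 a = 1 := by
  simp [mixAt, mix, (hv _).total]

theorem mixAt_mono (hv : ∀ i, IsAdditiveValuation (v i)) (hδ0 : 0 ≤ δ) (hδ1 : δ ≤ 1)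
    (a : Fin 4) : Monotone fun x => mixAt δ v x a := mix_monotone hv hδ0 hδ1 a

theorem mixAt_sub_le_width (hv : ∀ i, IsAdditiveValuation (v i)) (hδ0 : 0 ≤ δ) (hδ1 : δ ≤ 1)
    {x y : I} (hxy : x ≤ y) (a : Fin 4) : mixAt δ v y a - mixAt δ v x a ≤ width v x y := by
  rw [mixAt, mixAt, mix_sub_mix]
  exact (mix_nonneg_le hδ0 hδ1 (fun i => sub_nonneg.2 ((hv i).monotone hxy)) a).2

theorem realizes_approximate (hv : ∀ i, IsAdditiveValuation (v i)) (hδ0 : 0 ≤ δ) (hδ1 : δ ≤ 1)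
    (he : 0 < e) (hn : (7 / 8) ^ n * 16 ≤ e ^ 2) (hpos : Separates δ v pos z γ) (hz : 0 ≤ z)
    (hγ : 0 ≤ γ) (hzγ : z + γ ≤ 1) :
    Realizes v (approximate δ e pos γ n) (26 * n + 12) fun r =>
      |r.2 - z| ≤ e ∧ (γ = 0 → r.2 = mixAt δ v r.1 0) := by
  have hB : Brackets δ v z γ ![0, 1, 0, 1] :=
    ⟨zero_le_one, zero_le_one, (mixAt_zero hv 0).trans_le hz,
      (show z ≤ 1 by linarith).trans_eq (mixAt_one hv 0).symm,
      (mixAt_zero hv 0).trans_le (by linarith), hzγ.trans_eq (mixAt_one hv 0).symm⟩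
  have hw : width v 0 1 = 4 := by
    simp [width, (hv _).zero_zero, (hv _).total]
  refine (realizes_search hv hpos n hB).bind fun B hB' => (realizes_probe (B 0)).bind
    (M := 4 + (4 + 0)) fun p hp => (realizes_probe (B 1)).bind fun q hq =>
    (realizes_probe (B 2)).bind fun r hr => Realizes.pure ?_
  subst hp hq hr
  obtain ⟨⟨b1, b2, b3, b4, b5, b6⟩, hprod⟩ := hB'
  change _ ≤ (7 / 8) ^ n * (width v 0 1 * width v 0 1) at hprod
  rw [hw] at hprod
  have hd : ∀ x : I, mix δ (fun i => v i 0 x) 0 = mixAt δ v x 0 := fun _ => rfl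
  simp only [hd]
  have w1 := width_nonneg hv b1
  have w2 := width_nonneg hv b2
  have m1 := mixAt_sub_le_width hv hδ0 hδ1 b1 0
  have m2 := mixAt_sub_le_width hv hδ0 hδ1 b2 0
  split_ifs with h1
  · change width v (B 0) (B 1) ≤ e at h1
    refine ⟨?_, fun _ => rfl⟩
    rw [abs_le]; constructor <;> linarith
  · change ¬ width v (B 0) (B 1) ≤ e at h1
    -- The product of the widths is at most `e ^ 2`, so one of the two is at most `e`.
    have h2 : width v (B 2) (B 3) ≤ e := by
      by_contra! h2
      nlinarith
    refine ⟨?_, fun h0 => by simp [h0]⟩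
    rw [abs_le]; constructor <;> linarith

/-- Finds a point with the coordinate `t`, approximately. -/
noncomputable def locate (δ e : ℝ) (n : ℕ) (t : ℝ) : Subroutine I :=
  (approximate δ e (fun p _ => t ≤ p 0) 0 n).bind fun r => pure r.1

theorem realizes_locate (hv : ∀ i, IsAdditiveValuation (v i)) (hδ0 : 0 ≤ δ) (hδ1 : δ ≤ 1)
    (he : 0 < e) (hn : (7 / 8) ^ n * 16 ≤ e ^ 2) {t : ℝ} (ht0 : 0 ≤ t) (ht1 : t ≤ 1) :
    Realizes v (locate δ e n t) (26 * n + 12) fun x => |mixAt δ v x 0 - t| ≤ e := by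
  refine (realizes_approximate (pos := fun p _ => t ≤ p 0) hv hδ0 hδ1 he hn (z := t) (γ := 0)
    (fun x y =>
    ⟨fun h _ => not_le.2 h, fun h _ => h.le⟩) ht0 le_rfl (by linarith)).bind (M := 0)
    fun r hr => Realizes.pure ?_
  rw [← hr.2 rfl]
  exact hr.1

end

/-! ### The divisions of one level -/

/-- A division of the cake, together with the values `data k a` of the initial pieces
`[0, cut k]` under the mixed valuations of the agents. -/
structure Candidate where
  cut : Fin 5 → I
  monotone_cut : Monotone cut
  cut_zero : cut 0 = 0
  cut_last : cut 4 = 1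
  data : Fin 5 → Fin 4 → ℝ

namespace Candidate

/-- According to the data, agent `a` prefers no piece to piece `k` by more than `t`. -/
def Likes (C : Candidate) (t : ℝ) (a k : Fin 4) : Prop :=
  ∀ m : Fin 4, C.data m.succ a - C.data m.castSucc a ≤ C.data k.succ a - C.data k.castSucc a + t

/-- All of the agents `1`, `2`, `3` like one of the pieces `i`, `j`. -/
def Passes (C : Candidate) (τ : ℝ) (i j : Fin 4) : Prop :=
  ∀ a, a ≠ 0 → C.Likes τ a i ∨ C.Likes τ a j

/-- The data are truthful, and the cuts are near `c` in the coordinate of agent `0`. -/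
structure Near (C : Candidate) (δ : ℝ) (v : Fin 4 → I → I → ℝ) (e : ℝ) (c : Fin 5 → ℝ) :
    Prop where
  data_eq : ∀ k, C.data k = mixAt δ v (C.cut k)
  close : ∀ k, |mixAt δ v (C.cut k) 0 - c k| ≤ e

end Candidate

/-- The points `x`, with the first and last replaced by the ends of the cake, in order. -/
noncomputable def sortCuts (x : Fin 5 → I) (k : Fin 5) : I :=
  (Finset.Iic k).sup fun m => if m = 0 then 0 else if m = 4 then 1 else x m

theorem sortCuts_monotone (x : Fin 5 → I) : Monotone (sortCuts x) := fun _ _ h =>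
  Finset.sup_mono (Finset.Iic_subset_Iic.2 h)

theorem sortCuts_zero (x : Fin 5 → I) : sortCuts x 0 = 0 := by
  have : Finset.Iic (0 : Fin 5) = {0} := by decide
  simp [sortCuts, this]

theorem sortCuts_four (x : Fin 5 → I) : sortCuts x 4 = 1 := by
  refine le_antisymm (sortCuts x 4).2.2 ?_
  have := Finset.le_sup (f := fun m : Fin 5 => if m = 0 then (0 : I) else if m = 4 then 1 else x m)
    (Finset.mem_Iic.2 (le_refl (4 : Fin 5)))
  have h4 : sortCuts x 4 ≥ 1 := le_trans (by simp) this
  exact h4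

/-- Produces a division whose cuts have approximately the coordinates `c`. -/
noncomputable def divide (δ e : ℝ) (n : ℕ) (c : Fin 5 → ℝ) : Subroutine Candidate :=
  (all fun k => locate δ e n (c k)).bind fun x => (all fun k => probe (sortCuts x k)).bind fun p =>
    pure ⟨sortCuts x, sortCuts_monotone x, sortCuts_zero x, sortCuts_four x, fun k => mix δ (p k)⟩

/-- Finds an approximate median for the pair `i < j` at level `α`. -/
noncomputable def medianParam (δ e : ℝ) (n : ℕ) (i j : Fin 4) (α : ℝ) : Subroutine ℝ :=
  (locate δ e n ((i : ℕ) * α)).bind fun x => (locate δ e n (1 - (3 - (j : ℕ)) * α)).bind fun y =>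
    (probe x).bind fun p => (probe y).bind fun q =>
      (approximate δ e (LeftPreferred (mix δ p) (mix δ q)) (((j : ℕ) - (i : ℕ) - 1) * α) n).bind
        fun r => pure (clampParam i α r.2)

/-- The division of the pair `i < j` at level `α`. -/
noncomputable def divideAt (δ e : ℝ) (n : ℕ) (i j : Fin 4) (α : ℝ) : Subroutine Candidate :=
  (medianParam δ e n i j α).bind fun s => divide δ e n (pairCuts i j α s)

section
variable {v : Fin 4 → I → I → ℝ} {δ e : ℝ} {n : ℕ}

theorem mixAt_mem (hv : ∀ i, IsAdditiveValuation (v i)) (hδ0 : 0 ≤ δ) (hδ1 : δ ≤ 1)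
    (x : I) (a : Fin 4) : 0 ≤ mixAt δ v x a ∧ mixAt δ v x a ≤ 1 :=
  ⟨(mixAt_zero hv a).symm.trans_le (mixAt_mono hv hδ0 hδ1 a x.2.1),
    (mixAt_mono hv hδ0 hδ1 a x.2.2).trans_eq (mixAt_one hv a)⟩

theorem abs_mixAt_sortCuts_sub_le (hv : ∀ i, IsAdditiveValuation (v i)) (hδ0 : 0 ≤ δ)
    (hδ1 : δ ≤ 1) (he : 0 ≤ e) {c : Fin 5 → ℝ} (hc : Monotone c) (hc0 : c 0 = 0) (hc4 : c 4 = 1)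
    {x : Fin 5 → I} (hx : ∀ k, |mixAt δ v (x k) 0 - c k| ≤ e) (k : Fin 5) :
    |mixAt δ v (sortCuts x k) 0 - c k| ≤ e := by
  set y : Fin 5 → I := fun m => if m = 0 then 0 else if m = 4 then 1 else x m with hy
  have hyc : ∀ m, |mixAt δ v (y m) 0 - c m| ≤ e := by
    intro m
    simp only [hy]
    split_ifs with h1 h2
    · rw [h1, hc0, mixAt_zero hv]; simpa
    · rw [h2, hc4, mixAt_one hv]; simpa
    · exact hx m
  have hs : sortCuts x k = (Finset.Iic k).sup y := rfl
  obtain ⟨m, hm, hm'⟩ := Finset.exists_mem_eq_sup (Finset.Iic k) ⟨k, Finset.mem_Iic.2 le_rfl⟩ y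
  have h1 := mixAt_mono hv hδ0 hδ1 0 (Finset.le_sup (f := y) (Finset.mem_Iic.2 (le_refl k)))
  simp only at h1
  have h2 := abs_le.1 (hyc m)
  have h3 := abs_le.1 (hyc k)
  have h4 := hc (Finset.mem_Iic.1 hm)
  rw [hs, abs_le]
  rw [hm'] at h1 ⊢
  constructor <;> linarith

theorem realizes_divide (hv : ∀ i, IsAdditiveValuation (v i)) (hδ0 : 0 ≤ δ) (hδ1 : δ ≤ 1)
    (he : 0 < e) (hn : (7 / 8) ^ n * 16 ≤ e ^ 2) {c : Fin 5 → ℝ} (hc : Monotone c) (hc0 : c 0 = 0)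
    (hc4 : c 4 = 1) :
    Realizes v (divide δ e n c) (130 * n + 80) fun C => C.Near δ v e c := by
  refine Realizes.mono ((Realizes.all (N := 26 * n + 12) fun k => realizes_locate hv hδ0 hδ1 he hn
    (hc0.symm.trans_le (hc (Fin.zero_le k))) ((hc (Fin.le_last k)).trans_eq hc4)).bind
    (M := 5 * 4 + 0) fun x hx => (Realizes.all fun k => realizes_probe (sortCuts x k)).bind
    fun p hp => Realizes.pure ?_) (by lia) fun _ h => h
  exact ⟨fun k => congrArg (mix δ) (hp k),
    abs_mixAt_sortCuts_sub_le hv hδ0 hδ1 he.le hc hc0 hc4 hx⟩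

variable {κ η : ℝ} {h : Fin 4 → ℝ → ℝ}

theorem realizes_medianParam (hv : ∀ i, IsAdditiveValuation (v i)) (hδ0 : 0 ≤ δ) (hδ1 : δ ≤ 1)
    (he : 0 < e) (hn : (7 / 8) ^ n * 16 ≤ e ^ 2) (H : BiLip κ h)
    (hh : ∀ a x, h a (mixAt δ v x 0) = mixAt δ v x a) (heη : 10 * e ≤ κ * η) {i j : Fin 4}
    (hij : i < j) {α : ℝ} (hα1 : 1 / 4 ≤ α) (hα2 : α ≤ 1 / 2) :
    Realizes v (medianParam δ e n i j α) (78 * n + 44) fun s =>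
      IsMed h η i j α s ∧ 0 ≤ s ∧ s ≤ 1 - 2 * α := by
  have hi0 : (0 : ℝ) ≤ (i : ℕ) := Nat.cast_nonneg _
  have hj3 : ((j : ℕ) : ℝ) ≤ 3 := by
    have : (j : ℕ) ≤ 3 := by omega
    exact_mod_cast this
  have hij' : ((i : ℕ) : ℝ) + 1 ≤ (j : ℕ) := by exact_mod_cast hij
  have hx0 : (0 : ℝ) ≤ (i : ℕ) * α := mul_nonneg hi0 (by linarith)
  have hx1 : (i : ℕ) * α ≤ 1 := by nlinarith
  have hy0 : 0 ≤ 1 - (3 - ((j : ℕ) : ℝ)) * α := by nlinarith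
  have hy1 : 1 - (3 - ((j : ℕ) : ℝ)) * α ≤ 1 := by
    have : 0 ≤ (3 - ((j : ℕ) : ℝ)) * α := mul_nonneg (by linarith) (by linarith)
    linarith
  have hγ0 : 0 ≤ (((j : ℕ) : ℝ) - (i : ℕ) - 1) * α := mul_nonneg (by linarith) (by linarith)
  have hγ1 : (((j : ℕ) : ℝ) - (i : ℕ) - 1) * α ≤ 1 := by nlinarith
  refine ((realizes_locate hv hδ0 hδ1 he hn hx0 hx1).bind
    (M := 26 * n + 12 + (4 + (4 + (26 * n + 12 + 0)))) fun x hx =>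
    (realizes_locate hv hδ0 hδ1 he hn hy0 hy1).bind fun y hy =>
    (realizes_probe x).bind fun p hp => (realizes_probe y).bind fun q hq => ?_).mono
    (by lia) fun _ h => h
  subst hp hq
  obtain ⟨z, hz0, hz1, hz⟩ := exists_target
    (P := fun s t => LeftPreferred (mixAt δ v x) (mixAt δ v y) (fun a => h a s) fun a => h a t)
    (fun s t s' t' h1 h2 => LeftPreferred.mono (fun a => H.mono a h1) fun a => H.mono a h2) hγ1
  have hsep : Separates δ v (LeftPreferred (mixAt δ v x) (mixAt δ v y)) z
      (((j : ℕ) - (i : ℕ) - 1) * α) := by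
    intro s t
    have := hz (mixAt δ v s 0) (mixAt δ v t 0) (mixAt_mem hv hδ0 hδ1 s 0).1
      (mixAt_mem hv hδ0 hδ1 t 0).2
    simpa only [hh] using this
  refine (realizes_approximate hv hδ0 hδ1 he hn hsep hz0 hγ0 hz1).bind fun r hr =>
    Realizes.pure ?_
  refine ⟨H.isMed_clampParam he heη hij hα1 hα2 (fun a => ?_) (fun a => ?_) hz hr.1,
    (clampParam_mem hα1 hα2).1, (clampParam_mem hα1 hα2).2.2.2⟩
  · rw [← hh]; exact H.abs_sub_le a hx
  · rw [← hh]; exact H.abs_sub_le a hy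

theorem pairCuts_monotone {i j : Fin 4} {α s : ℝ} (hα : 0 ≤ α) (hs0 : 0 ≤ s)
    (hs1 : s ≤ 1 - 2 * α) : Monotone (pairCuts i j α s) := by
  refine Fin.monotone_iff_le_succ.2 fun k => sub_nonneg.1 ?_
  rw [pairCuts, cutsOf_succ_sub]
  unfold pairLen
  split_ifs <;> linarith

theorem realizes_divideAt (hv : ∀ i, IsAdditiveValuation (v i)) (hδ0 : 0 ≤ δ) (hδ1 : δ ≤ 1)
    (he : 0 < e) (hn : (7 / 8) ^ n * 16 ≤ e ^ 2) (H : BiLip κ h)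
    (hh : ∀ a x, h a (mixAt δ v x 0) = mixAt δ v x a) (heη : 10 * e ≤ κ * η) {i j : Fin 4}
    (hij : i < j) {α : ℝ} (hα1 : 1 / 4 ≤ α) (hα2 : α ≤ 1 / 2) :
    Realizes v (divideAt δ e n i j α) (208 * n + 124) fun C =>
      ∃ s, IsMed h η i j α s ∧ C.Near δ v e (pairCuts i j α s) := by
  refine ((realizes_medianParam hv hδ0 hδ1 he hn H hh heη hij hα1 hα2).bind
    (M := 130 * n + 80) fun s hs => (realizes_divide hv hδ0 hδ1 he hn
      (pairCuts_monotone (by linarith) hs.2.1 hs.2.2) (cutsOf_zero _)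
      (pairCuts_four hij.ne _ _)).mono le_rfl fun C hC => ⟨s, hs.1, hC⟩).mono (by lia) fun _ h => h

/-- The data of a candidate decide, up to a tolerance, who likes what. -/
theorem Candidate.Near.fav (H : BiLip κ h) (hh : ∀ a x, h a (mixAt δ v x 0) = mixAt δ v x a)
    {C : Candidate} {c : Fin 5 → ℝ} (hC : C.Near δ v e c) {t t' : ℝ} (ht : 4 * e ≤ κ * (t' - t))
    {a k : Fin 4} : (C.Likes t a k → Fav h c t' a k) ∧ (Fav h c t a k → C.Likes t' a k) := by
  have key : ∀ t, C.Likes t a k ↔ Fav h (fun k => mixAt δ v (C.cut k) 0) t a k := by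
    intro t
    simp only [Candidate.Likes, Fav, piece, hC.data_eq, hh]
  rw [key, key]
  refine ⟨H.fav_of_close hC.close ht, H.fav_of_close (fun k => ?_) ht⟩
  rw [abs_sub_comm]
  exact hC.close k

end

/-! ### Bisection over the levels -/

/-- Goes through the list of pairs until the division of some pair passes the test. -/
noncomputable def tryPairs (δ e : ℝ) (n : ℕ) (τ α : ℝ) :
    List (Fin 4 × Fin 4) → Subroutine (Option Candidate)
  | [] => pure none
  | p :: ps => (divideAt δ e n p.1 p.2 α).bind fun C => by
      classical exact if C.Passes τ p.1 p.2 then pure (some C) else tryPairs δ e n τ α ps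

/-- The pairs of pieces. -/
def pairs : List (Fin 4 × Fin 4) := [(0, 1), (0, 2), (0, 3), (1, 2), (1, 3), (2, 3)]

/-- Bisects the levels between `lo`, where `C` passes the test, and `hi`, where no pair does.
Returns a candidate that passes next to a level where no pair does. -/
noncomputable def bisectLevels (δ e : ℝ) (n : ℕ) (τ : ℝ) :
    ℕ → ℝ → ℝ → Candidate → Subroutine Candidate
  | 0, _, _, C => pure C
  | N + 1, lo, hi, C => (tryPairs δ e n τ ((lo + hi) / 2) pairs).bind fun r =>
      match r with
      | none => bisectLevels δ e n τ N lo ((lo + hi) / 2) C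
      | some C' => bisectLevels δ e n τ N ((lo + hi) / 2) hi C'

/-- Computes a division that can be allotted with little envy. -/
noncomputable def findDivision (δ e : ℝ) (n : ℕ) (τ : ℝ) : Subroutine Candidate :=
  (tryPairs δ e n τ (1 / 4) pairs).bind fun r =>
    match r with
    | none => divideAt δ e n 0 1 (1 / 4)
    | some C => bisectLevels δ e n τ n (1 / 4) (1 / 2) C

/-- The candidate comes from a pair that attracts all agents at level `α`. -/
def Attractive (h : Fin 4 → ℝ → ℝ) (η ζ δ e : ℝ) (v : Fin 4 → I → I → ℝ) (α : ℝ)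
    (C : Candidate) : Prop :=
  ∃ i j s, i ≠ j ∧ IsMed h η i j α s ∧ C.Near δ v e (pairCuts i j α s) ∧
    ∀ a, a ≠ 0 → Fav h (pairCuts i j α s) ζ a i ∨ Fav h (pairCuts i j α s) ζ a j

/-- The valuations, the tolerances and the numbers of steps fit together. -/
structure Setup (v : Fin 4 → I → I → ℝ) (h : Fin 4 → ℝ → ℝ) (κ δ e τ η ξ ζ θ : ℝ) (n : ℕ) :
    Prop where
  valuation : ∀ i, IsAdditiveValuation (v i)
  δ_nonneg : 0 ≤ δ
  δ_le : δ ≤ 1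
  e_pos : 0 < e
  steps : (7 / 8) ^ n * 16 ≤ e ^ 2
  biLip : BiLip κ h
  eq_mixAt : ∀ a x, h a (mixAt δ v x 0) = mixAt δ v x a
  scales : Scales κ η ξ ζ θ
  e_le_η : 10 * e ≤ κ * η
  e_le_ζ : 4 * e ≤ κ * (ζ - τ)
  e_le_ξ : 4 * e ≤ κ * (τ - ξ)
  e_le_θ : 4 * e ≤ κ * θ
  ξ_lt : ξ < κ / 2

section
variable {v : Fin 4 → I → I → ℝ} {h : Fin 4 → ℝ → ℝ} {κ δ e τ η ξ ζ θ : ℝ} {n : ℕ}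

theorem Setup.realizes_divideAt (S : Setup v h κ δ e τ η ξ ζ θ n) {i j : Fin 4} (hij : i < j)
    {α : ℝ} (hα1 : 1 / 4 ≤ α) (hα2 : α ≤ 1 / 2) :
    Realizes v (divideAt δ e n i j α) (208 * n + 124) fun C =>
      ∃ s, IsMed h η i j α s ∧ C.Near δ v e (pairCuts i j α s) :=
  _root_.realizes_divideAt S.valuation S.δ_nonneg S.δ_le S.e_pos S.steps S.biLip S.eq_mixAt
    S.e_le_η hij hα1 hα2

theorem Setup.realizes_tryPairs_list (S : Setup v h κ δ e τ η ξ ζ θ n) {α : ℝ}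
    (hα1 : 1 / 4 ≤ α) (hα2 : α ≤ 1 / 2) : ∀ ps : List (Fin 4 × Fin 4), (∀ p ∈ ps, p.1 < p.2) →
    Realizes v (tryPairs δ e n τ α ps) (ps.length * (208 * n + 124)) fun r =>
      (∀ C, r = some C → Attractive h η ζ δ e v α C) ∧
      (r = none → ∀ p ∈ ps, ∃ s, IsMed h η p.1 p.2 α s ∧ ∃ a, a ≠ 0 ∧
        ¬ Fav h (pairCuts p.1 p.2 α s) ξ a p.1 ∧ ¬ Fav h (pairCuts p.1 p.2 α s) ξ a p.2)
  | [], _ => Realizes.mono (Realizes.pure ⟨by simp, by simp⟩) (by simp) fun _ h => h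
  | p :: ps, hps => by
    have hp := hps p (by simp)
    refine Realizes.mono ((S.realizes_divideAt hp hα1 hα2).bind
      (M := ps.length * (208 * n + 124)) fun C hC => ?_)
      (by simp only [List.length_cons]; lia) fun _ h => h
    obtain ⟨s, hs, hC⟩ := hC
    split_ifs with hpass
    · refine Realizes.mono (Realizes.pure ⟨?_, by simp⟩) (Nat.zero_le _) fun _ h => h
      rintro _ ⟨⟩
      exact ⟨p.1, p.2, s, hp.ne, hs, hC, fun a ha => (hpass a ha).imp
        (hC.fav S.biLip S.eq_mixAt S.e_le_ζ).1 (hC.fav S.biLip S.eq_mixAt S.e_le_ζ).1⟩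
    · refine Realizes.mono (S.realizes_tryPairs_list hα1 hα2 ps fun q hq => hps q (by simp [hq]))
        le_rfl fun r hr => ⟨hr.1, fun h0 q hq => ?_⟩
      rcases List.mem_cons.1 hq with rfl | hq
      · unfold Candidate.Passes at hpass
        push Not at hpass
        obtain ⟨a, ha, h1, h2⟩ := hpass
        exact ⟨s, hs, a, ha, fun hf => h1 ((hC.fav S.biLip S.eq_mixAt S.e_le_ξ).2 hf),
          fun hf => h2 ((hC.fav S.biLip S.eq_mixAt S.e_le_ξ).2 hf)⟩
      · exact hr.2 h0 q hq

theorem Setup.realizes_tryPairs (S : Setup v h κ δ e τ η ξ ζ θ n) {α : ℝ}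
    (hα1 : 1 / 4 ≤ α) (hα2 : α ≤ 1 / 2) :
    Realizes v (tryPairs δ e n τ α pairs) (6 * (208 * n + 124)) fun r =>
      (∀ C, r = some C → Attractive h η ζ δ e v α C) ∧ (r = none → FailsAt h η ξ α) := by
  refine (S.realizes_tryPairs_list hα1 hα2 pairs (by decide)).mono le_rfl
    fun r hr => ⟨hr.1, fun h0 => ?_⟩
  have hlt : ∀ i j : Fin 4, i < j → ∃ s, IsMed h η i j α s ∧ ∃ a, a ≠ 0 ∧
      ¬ Fav h (pairCuts i j α s) ξ a i ∧ ¬ Fav h (pairCuts i j α s) ξ a j := by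
    intro i j hij
    have hmem : (i, j) ∈ pairs := by revert i j; decide
    exact hr.2 h0 _ hmem
  intro i j hij
  rcases lt_or_gt_of_ne hij with h1 | h1
  · exact hlt i j h1
  · obtain ⟨s, hs, a, ha, h2, h3⟩ := hlt j i h1
    refine ⟨1 - 2 * α - s, hs.swap hij.symm, a, ha, ?_⟩
    rw [pairCuts_swap hij.symm]
    exact ⟨h3, h2⟩

theorem Setup.realizes_bisectLevels (S : Setup v h κ δ e τ η ξ ζ θ n) :
    ∀ (N : ℕ) {lo hi : ℝ} {C : Candidate}, 1 / 4 ≤ lo → lo ≤ hi → hi ≤ 1 / 2 →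
    Attractive h η ζ δ e v lo C → FailsAt h η ξ hi →
    Realizes v (bisectLevels δ e n τ N lo hi C) (N * (6 * (208 * n + 124))) fun C' =>
      ∃ lo' hi', 1 / 4 ≤ hi' ∧ |lo' - hi'| ≤ (hi - lo) / 2 ^ N ∧ Attractive h η ζ δ e v lo' C' ∧
        FailsAt h η ξ hi'
  | 0, lo, hi, C, h1, h2, h3, hC, hf => by
    refine Realizes.mono (Realizes.pure ⟨lo, hi, by linarith, ?_, hC, hf⟩) (by simp) fun _ h => h
    rw [abs_sub_comm, abs_of_nonneg (by linarith)]; simp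
  | N + 1, lo, hi, C, h1, h2, h3, hC, hf => by
    refine Realizes.mono ((S.realizes_tryPairs (α := (lo + hi) / 2) (by linarith)
      (by linarith)).bind (M := N * (6 * (208 * n + 124))) fun r hr => ?_) (by lia) fun _ h => h
    have hlen : ((lo + hi) / 2 - lo) / 2 ^ N = (hi - lo) / 2 ^ (N + 1) ∧
        (hi - (lo + hi) / 2) / 2 ^ N = (hi - lo) / 2 ^ (N + 1) := by
      constructor <;> (rw [pow_succ]; field_simp; ring)
    match r, hr with
    | none, hr =>
      have := S.realizes_bisectLevels N h1 (by linarith) (by linarith) hC (hr.2 rfl)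
      rwa [hlen.1] at this
    | some C', hr =>
      have := S.realizes_bisectLevels N (by linarith) (by linarith) h3 (hr.1 C' rfl) hf
      rwa [hlen.2] at this

theorem Setup.realizes_findDivision (S : Setup v h κ δ e τ η ξ ζ θ n) (hN : 1 / 4 / 2 ^ n ≤ η) :
    Realizes v (findDivision δ e n τ) ((6 * n + 7) * (208 * n + 124)) fun C =>
      (∀ k, C.data k = mixAt δ v (C.cut k)) ∧
      ∃ g : Equiv.Perm (Fin 4), ∀ a, C.Likes (2 * θ) a (g a) := by
  have hθ := S.scales.θ_nonneg
  refine Realizes.mono ((S.realizes_tryPairs (α := 1 / 4) le_rfl (by norm_num)).bind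
    (M := (6 * n + 1) * (208 * n + 124)) fun r hr => ?_) (by lia) fun _ h => h
  match r, hr with
  | none, hr =>
    refine (S.realizes_divideAt (i := 0) (j := 1) (α := 1 / 4) (by decide) le_rfl
      (by norm_num)).mono (by lia) fun C hC => ?_
    obtain ⟨s, hs, hC⟩ := hC
    obtain ⟨g, hg⟩ := S.biLip.exists_perm_of_failsAt_quarter S.scales.ξ_nonneg (hr.2 rfl) hs
    refine ⟨hC.data_eq, g, fun a => (hC.fav S.biLip S.eq_mixAt (t := θ) ?_).2
      ((hg a).mono hθ)⟩
    linarith [S.e_le_θ]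
  | some C, hr =>
    refine (S.realizes_bisectLevels n (by norm_num) (by norm_num) le_rfl (hr.1 C rfl)
      (S.biLip.failsAt_half S.scales.nonneg S.ξ_lt)).mono (by lia) fun C' hC' => ?_
    obtain ⟨lo, hi, h1, h2, ⟨i, j, s, hij, hs, hC, hpass⟩, hfail⟩ := hC'
    obtain ⟨g, hg⟩ := S.biLip.exists_perm_of_step S.scales hij h1
      (h2.trans (le_trans (by norm_num) hN)) hs hpass hfail
    refine ⟨hC.data_eq, g, fun a => (hC.fav S.biLip S.eq_mixAt ?_).2 (hg a)⟩
    linarith [S.e_le_θ]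

end

/-! ### The protocol -/

/-- The allocation that divides the cake as `C` does and gives piece `g i` to agent `i`. -/
def Candidate.allocation (C : Candidate) (g : Equiv.Perm (Fin 4)) : ConnectedAllocation 4 where
  cut := C.cut
  monotone_cut := C.monotone_cut
  cut_zero := C.cut_zero
  cut_last := C.cut_last
  assign := g

/-- Outputs an allocation in which, according to the data, everybody likes her piece up to `t`, if
there is one. -/
noncomputable def Candidate.finish (t : ℝ) (C : Candidate) : RWProtocol 4 := by
  classical
  exact .output (C.allocation (if hg : ∃ g : Equiv.Perm (Fin 4), ∀ a, C.Likes t a (g a)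
    then hg.choose else 1))

/-- Little envy under the mixed valuations means little envy under the valuations themselves. -/
theorem Candidate.isEpsEnvyFree_allocation {v : Fin 4 → I → I → ℝ}
    (hv : ∀ i, IsAdditiveValuation (v i)) {δ t ε : ℝ} (hδ0 : 0 ≤ δ) (hε : t + 2 * δ ≤ ε)
    {C : Candidate} (hC : ∀ k, C.data k = mixAt δ v (C.cut k)) {g : Equiv.Perm (Fin 4)}
    (hg : ∀ a, C.Likes t a (g a)) : (C.allocation g).IsEpsEnvyFree v ε := by
  intro a b
  have hle : ∀ k : Fin 4, C.cut k.castSucc ≤ C.cut k.succ := fun k =>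
    C.monotone_cut (Fin.castSucc_lt_succ).le
  change v a (C.cut (g a).castSucc) (C.cut (g a).succ) ≥
    v a (C.cut (g b).castSucc) (C.cut (g b).succ) - ε
  rw [(hv a).eq_sub (hle _), (hv a).eq_sub (hle _)]
  have h1 := hg a (g b)
  rw [hC, hC, hC, hC] at h1
  unfold mixAt at h1
  rw [mix_sub_mix, mix_sub_mix] at h1
  have h0 : ∀ i k, 0 ≤ v i 0 (C.cut (Fin.succ k)) - v i 0 (C.cut (Fin.castSucc k)) :=
    fun i k => sub_nonneg.2 ((hv i).monotone (hle k))
  have h2 : ∀ i k, v i 0 (C.cut (Fin.succ k)) - v i 0 (C.cut (Fin.castSucc k)) ≤ 1 := by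
    intro i k
    have e1 := (hv i).monotone (show C.cut (Fin.succ k) ≤ 1 from (C.cut (Fin.succ k)).2.2)
    have e2 := (hv i).nonneg 0 (C.cut (Fin.castSucc k))
    rw [(hv i).total] at e1
    linarith
  have h3 : 0 ≤ ∑ i, (v i 0 (C.cut (g b).succ) - v i 0 (C.cut (g b).castSucc)) :=
    Finset.sum_nonneg fun i _ => h0 i _
  have h4 : ∑ i, (v i 0 (C.cut (g a).succ) - v i 0 (C.cut (g a).castSucc)) ≤ 4 := by
    calc _ ≤ ∑ _i : Fin 4, (1 : ℝ) := Finset.sum_le_sum fun i _ => h2 i _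
      _ = 4 := by simp
  have h5 := h2 a (g b)
  have h6 := h0 a (g a)
  nlinarith

/-- The number of bisection steps used for the tolerance `ε`. -/
noncomputable def stepCount (ε : ℝ) : ℕ := ⌈200 * Real.log (16 / ε)⌉₊

/-- The protocol for the tolerance `ε`. -/
noncomputable def protocol (ε : ℝ) : RWProtocol 4 :=
  findDivision (ε / 4) ((ε / 16) ^ 12) (stepCount ε) ((ε / 16) ^ 5) (Candidate.finish (ε / 2))

theorem pow_stepCount_le {ε : ℝ} (h0 : 0 < ε) (h1 : ε ≤ 1) :
    (7 / 8 : ℝ) ^ stepCount ε * 16 ≤ (ε / 16) ^ 24 := by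
  have h2 : (7 / 8 : ℝ) ^ stepCount ε ≤ (ε / 16) ^ 25 := by
    calc (7 / 8 : ℝ) ^ stepCount ε ≤ Real.exp (-(1 / 8)) ^ stepCount ε := by
          gcongr
          linarith [Real.add_one_le_exp (-(1 / 8 : ℝ))]
      _ = Real.exp (stepCount ε * -(1 / 8)) := (Real.exp_nat_mul _ _).symm
      _ ≤ Real.exp ((25 : ℕ) * Real.log (ε / 16)) := by
          refine Real.exp_le_exp.2 ?_
          have h3 : 200 * Real.log (16 / ε) ≤ stepCount ε := Nat.le_ceil _
          have h4 : Real.log (16 / ε) = -Real.log (ε / 16) := by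
            rw [← Real.log_inv, inv_div]
          rw [h4] at h3
          push_cast
          linarith
      _ = (ε / 16) ^ 25 := by rw [Real.exp_nat_mul, Real.exp_log (by positivity)]
  have h3 : (ε / 16) ^ 25 = (ε / 16) ^ 24 * (ε / 16) := pow_succ _ _
  have h4 : 0 < (ε / 16) ^ 24 := by positivity
  nlinarith

theorem exists_setup {v : Fin 4 → I → I → ℝ} (hv : ∀ i, IsAdditiveValuation (v i)) {ε : ℝ}
    (h0 : 0 < ε) (h1 : ε ≤ 1) :
    ∃ h, Setup v h (ε / 16) (ε / 4) ((ε / 16) ^ 12) ((ε / 16) ^ 5) ((ε / 16) ^ 9)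
      ((ε / 16) ^ 5 / 2) (2 * (ε / 16) ^ 5) (ε / 4) (stepCount ε) := by
  obtain ⟨h, H, hh⟩ := exists_biLip hv (δ := ε / 4) (by positivity) (by linarith)
  rw [show ε / 4 / 4 = ε / 16 by ring] at H
  have hsteps := pow_stepCount_le h0 h1
  have hθ : ε / 4 = 4 * (ε / 16) := by ring
  set κ := ε / 16 with hκ
  have k0 : 0 < κ := by positivity
  have k1 : κ ≤ 1 / 16 := by rw [hκ]; linarith
  -- Every power of `κ` is at most a sixteenth of the preceding one.
  have step : ∀ m : ℕ, 16 * κ ^ (m + 1) ≤ κ ^ m := fun m => by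
    have := pow_pos k0 m
    rw [pow_succ]
    nlinarith
  have p : ∀ m : ℕ, 0 < κ ^ m := fun m => pow_pos k0 m
  have s1 := step 1
  have s2 := step 2
  have s3 := step 3
  have s4 := step 4
  have s5 := step 5
  have s6 := step 6
  have s7 := step 7
  have s8 := step 8
  have s9 := step 9
  have s10 := step 10
  have s11 := step 11
  norm_num at s1 s2 s3 s4 s5 s6 s7 s8 s9 s10 s11
  refine ⟨h, hv, by positivity, by linarith, by positivity, ?_, H, hh,
    ⟨(p 9).le, by have := p 5; linarith, by have := p 5; linarith, by linarith, ?_, ?_, ?_, ?_⟩,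
    ?_, ?_, ?_, ?_, ?_⟩
  · rw [← pow_mul]; exact hsteps
  · rw [show κ ^ 2 * (κ ^ 5 / 2) = κ ^ 7 / 2 by ring]; linarith [p 7, p 8]
  · rw [show κ * (2 * κ ^ 5 - κ ^ 9) = 2 * κ ^ 6 - κ ^ 10 by ring]; linarith [p 6, p 7, p 8]
  · rw [hθ, show κ ^ 2 * (4 * κ / 2) = 2 * κ ^ 3 by ring]; linarith [p 3, p 4, p 5, p 6]
  · rw [hθ, show κ ^ 3 * (4 * κ) = 4 * κ ^ 4 by ring]; linarith [p 4, p 5, p 6, p 7]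
  · rw [show κ * κ ^ 9 = κ ^ 10 by ring]; linarith [p 10, p 11]
  · rw [show κ * (2 * κ ^ 5 - κ ^ 5) = κ ^ 6 by ring]; linarith [p 6, p 7, p 8, p 9, p 10, p 11]
  · rw [show κ * (κ ^ 5 - κ ^ 5 / 2) = κ ^ 6 / 2 by ring]
    linarith [p 6, p 7, p 8, p 9, p 10, p 11]
  · rw [hθ, show κ * (4 * κ) = 4 * κ ^ 2 by ring]
    linarith [p 2, p 3, p 4, p 5, p 6, p 7, p 8, p 9, p 10, p 11]
  · linarith [p 1, p 2, p 3, p 4]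

theorem protocol_spec {v : Fin 4 → I → I → ℝ} (hv : ∀ i, IsAdditiveValuation (v i)) {ε : ℝ}
    (h0 : 0 < ε) (h1 : ε ≤ 1) {q : ℕ} {A : ConnectedAllocation 4}
    (hrun : RWProtocol.Run v (protocol ε) q A) :
    A.IsEpsEnvyFree v ε ∧ q ≤ (6 * stepCount ε + 7) * (208 * stepCount ε + 124) := by
  obtain ⟨h, S⟩ := exists_setup hv h0 h1
  have hN : 1 / 4 / 2 ^ stepCount ε ≤ (ε / 16) ^ 9 := by
    have e1 := pow_stepCount_le h0 h1
    have e2 : (ε / 16) ^ 24 ≤ (ε / 16) ^ 9 :=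
      pow_le_pow_of_le_one (by positivity) (by linarith) (by norm_num)
    have e3 : (1 / 2 : ℝ) ^ stepCount ε ≤ (7 / 8) ^ stepCount ε :=
      pow_le_pow_left₀ (by norm_num) (by norm_num) _
    have e4 : 0 < (1 / 2 : ℝ) ^ stepCount ε := by positivity
    have e5 : 1 / 4 / 2 ^ stepCount ε = 1 / 4 * (1 / 2 : ℝ) ^ stepCount ε := by
      rw [one_div_pow]; ring
    rw [e5]
    linarith
  obtain ⟨C, q', ⟨hdata, hg⟩, hfin, hq⟩ := S.realizes_findDivision hN _ q A hrun
  rw [show 2 * (ε / 4) = ε / 2 by ring] at hg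
  rw [Candidate.finish, dif_pos hg] at hfin
  cases hfin with
  | output =>
    exact ⟨C.isEpsEnvyFree_allocation hv (by positivity) (by linarith) hdata hg.choose_spec,
      by simpa using hq⟩

theorem stepCount_bound {ε : ℝ} (h0 : 0 < ε) (h1 : ε ≤ 1 / 2) :
    (((6 * stepCount ε + 7) * (208 * stepCount ε + 124) : ℕ) : ℝ) ≤
      10 ^ 10 * Real.log (1 / ε) ^ 2 := by
  set L := Real.log (1 / ε) with hL
  have hL2 : Real.log 2 ≤ L := Real.log_le_log (by norm_num) (by rw [le_div_iff₀ h0]; linarith)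
  have h16 : Real.log (16 / ε) ≤ 5 * L := by
    have e1 : Real.log (16 / ε) = 4 * Real.log 2 + L := by
      rw [hL, show 16 / ε = 2 ^ 4 * (1 / ε) by ring, Real.log_mul (by norm_num) (by positivity),
        Real.log_pow]
      norm_num
    linarith
  have hhalf := Real.log_two_gt_d9
  have hnn : (0 : ℝ) ≤ 200 * Real.log (16 / ε) := by
    have : 0 ≤ Real.log (16 / ε) := Real.log_nonneg (by rw [le_div_iff₀ h0]; linarith)
    positivity
  have hn : (stepCount ε : ℝ) ≤ 1002 * L := by
    have := (Nat.ceil_lt_add_one hnn).le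
    change (stepCount ε : ℝ) ≤ _ at this
    linarith
  have hn0 : (0 : ℝ) ≤ stepCount ε := Nat.cast_nonneg _
  push_cast
  calc (6 * (stepCount ε : ℝ) + 7) * (208 * stepCount ε + 124)
      ≤ (6026 * L) * (208664 * L) := by
        refine mul_le_mul ?_ ?_ (by positivity) ?_ <;> linarith
    _ ≤ 10 ^ 10 * L ^ 2 := by nlinarith [sq_nonneg L]

theorem exists_log_sq_lt {C c ε₀ : ℝ} (hc : 0 < c) (hε₀ : 0 < ε₀) :
    ∃ ε, 0 < ε ∧ ε < ε₀ ∧ ε ≤ 1 / 2 ∧ C * Real.log (1 / ε) ^ 2 + 1 < c / ε := by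
  have h1 : (fun t : ℝ => C * Real.log t ^ 2 + 1) =o[Filter.atTop] (id : ℝ → ℝ) :=
    ((Real.isLittleO_pow_log_id_atTop (n := 2)).const_mul_left C).add
      (Asymptotics.isLittleO_const_id_atTop 1)
  obtain ⟨t, ht, h2, h3⟩ := ((h1.bound (half_pos hc)).and
    ((Filter.eventually_ge_atTop 2).and (Filter.eventually_gt_atTop (1 / ε₀)))).exists
  have t0 : 0 < t := by linarith
  refine ⟨1 / t, by positivity, ?_, ?_, ?_⟩
  · rw [div_lt_iff₀ hε₀] at h3
    rw [div_lt_iff₀ t0]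
    linarith
  · exact one_div_le_one_div_of_le (by norm_num) h2
  · rw [one_div_one_div, div_div_eq_mul_div, div_one]
    rw [Real.norm_eq_abs, Real.norm_eq_abs, id, abs_of_pos t0] at ht
    have := le_abs_self (C * Real.log t ^ 2 + 1)
    nlinarith

theorem mainTheorem5 :
    (∃ (C : ℝ) (P : ℝ → RWProtocol 4), ∀ ε : ℝ, 0 < ε → ε ≤ 1 →
      (P ε).ComputesEpsEnvyFree ε ∧
      (ε ≤ 1 / 2 → (P ε).QueriesAtMost (C * Real.log (1 / ε) ^ 2))) ∧
    ¬ BranzeiNisanConjecture := by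
  have main : ∀ ε : ℝ, 0 < ε → ε ≤ 1 → (protocol ε).ComputesEpsEnvyFree ε ∧
      (ε ≤ 1 / 2 → (protocol ε).QueriesAtMost (10 ^ 10 * Real.log (1 / ε) ^ 2)) :=
    fun ε h0 h1 => ⟨fun v hv q A hrun => (protocol_spec hv h0 h1 hrun).1,
      fun h2 v hv q A hrun => le_trans (by exact_mod_cast (protocol_spec hv h0 h1 hrun).2)
        (stepCount_bound h0 h2)⟩
  refine ⟨⟨10 ^ 10, protocol, main⟩, ?_⟩
  rintro ⟨c, hc, ε₀, hε₀, H⟩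
  obtain ⟨ε, h0, h1, h2, h3⟩ := exists_log_sq_lt (C := 10 ^ 10) hc hε₀
  obtain ⟨m1, m2⟩ := main ε h0 (by linarith)
  have hnn : 0 ≤ 10 ^ 10 * Real.log (1 / ε) ^ 2 := by positivity
  have h4 := H ε h0 h1 (protocol ε) ⌈10 ^ 10 * Real.log (1 / ε) ^ 2⌉₊ m1
    fun v hv q A hrun => (m2 h2 v hv q A hrun).trans (Nat.le_ceil _)
  linarith [Nat.ceil_lt_add_one hnn]
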